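/- **Parameters.** Let $\tau=0.08$, $\nu=0.631$, $\eta=0.05$, $\varepsilon'=0.34$, $\varepsilon=\varepsilon'-\eta=0.29$. Let $n,k',r'\ge 1$ be integers with $d=(2k'+3)r'\le n^{0.01}$ and $k'\ge \varepsilon'\log_2 n+1$, and put $r=2\tau r'$ and $k=2k'r'$. Let $a$ and $\ell$ be integers with $|a-n^{\eta}|<1$ and $|\ell-\varepsilon'\log_2 n|<1$ (the roundings of $n^\eta$ and $\varepsilon'\log n$). Let $N=2r'n\,(a+2(k'-\ell-1)+\ell)$ and $L_2=(a\,2^{k'-\ell-1})^{2r'}$. Let $\Gamma\ge 0$ be defined by $(1+\Gamma)^{k'}=2n^{\varepsilon}$, and let $m\ge 0$ be an integer with $|m-\frac N2(1-\Gamma)|<1$. **Restrictions.** Let $\mathbb F$ be a field and let $\mathsf{IMM}_{n,d}=\sum_{i_1,\dots,i_{d-1}\in[n]}x^{(1)}_{1,i_1}x^{(2)}_{i_1,i_2}\cdots x^{(d)}_{i_{d-1},1}\in\mathbb F[X]$. Cut the $d$ matrices into $r'$ contiguous blocks of $2k'+3$ matrices; the $i$th block is $X^{(i,L,k'+1)},\dots,X^{(i,L,1)},X^{(i)},X^{(i,R,1)},\dots,X^{(i,R,k'+1)}$.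 A random restriction $V\leftarrow D$ acts as follows, for every $i\in[r']$. * The entries of $X^{(i)}$ become distinct variables $y^{(i)}_{p,q}$ (the set $Y$). * In $X^{(i,L,k'+1)}$ the first row is set to $1$ and the rest to $0$. In $X^{(i,R,k'+1)}$ the first column is set to $1$ and the rest to $0$. * The entries of $X^{(i,b,j)}$, for $b\in\{L,R\}$ and $j\in[k']$, become distinct variables. In each column (if $b=L$) or row (if $b=R$), independently, a uniformly random set of $\deg_j$ entries is kept and the other entries are set to $0$. Here $\deg_1=a$, $\deg_j=2$ for $2\le j\le k'-\ell$, and $\deg_j=1$ for $j>k'-\ell$. Let $Z$ be the set of the variables kept in the matrices $X^{(i,b,j)}$ with $b\in\{L,R\}$ and $j\in[k']$, and let $P|_V\in\mathbb F[Y\sqcup Z]$ be the restricted polynomial. **Monomials.** Let $\mathcal P\subseteq[n]^{2r'}$ be any set such that any two distinct elements of $\mathcal P$ agree in at most $r$ coordinates. Let $\mathcal M=\{\prod_{i\in[r']}y^{(i)}_{a_{2i-1},a_{2i}}:(a_1,\dots,a_{2r'})\in\mathcal P\}$. For $\alpha\in\mathcal M$ let $\sigma_Y(\partial_\alpha P)$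 be obtained from $\partial_\alpha P$ by setting all the $Y$-variables to $0$, and let $M(\alpha)$ be the set of monomials in its support. Let $\mathrm{mult}$ delete all the non-multilinear monomials of a polynomial, and let $\mathsf{LM}$ be the leading monomial with respect to an arbitrary fixed monomial order. For $\beta\in M(\alpha)$, with $\gamma,\gamma'$ ranging over monomials in $Z$, let $$S_m(\alpha,\beta)=\{\gamma:\deg\gamma=|\mathrm{supp}(\gamma)|=m,\ \mathrm{supp}(\gamma)\cap\mathrm{supp}(\beta)=\emptyset\},$$ $$A_m(\alpha,\beta)=\{\gamma'\text{ multilinear}:\deg\gamma'=\deg P-r'+m,\ \exists\gamma:\ \gamma'=\mathsf{LM}(\mathrm{mult}(\gamma\cdot\sigma_Y(\partial_\alpha P)))=\gamma\beta\},$$ where the polynomial $\mathrm{mult}(\gamma\cdot\sigma_Y(\partial_\alpha P))$ is required to be non-zero. Put $$T_1(P,\alpha)=\sum_{\beta\in M(\alpha)}|S_m(\alpha,\beta)|,\qquad T_2(P,\alpha)=\sum_{\substack{\beta,\gamma\in M(\alpha)\\ \beta\ne\gamma}}|S_m(\alpha,\beta)\cap S_m(\alpha,\gamma)|,$$ $$T_3(P,\alpha,\alpha')=\sum_{\substack{\beta\in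 M(\alpha),\ \gamma\in M(\alpha')\\(\alpha,\beta)\ne(\alpha',\gamma)}}|A_m(\alpha,\beta)\cap A_m(\alpha',\gamma)|.$$ **Lemma.** There is an absolute constant $C$ such that, for all data as above, the following hold. 1. For every $V$ in the support of $D$: $|Z|=N$, and for every $\alpha\in\mathcal M$, $|M(\alpha)|=L_2$ and $T_1(P|_V,\alpha)=L_2\binom{N-k}{m}$. 2. For every $\alpha\in\mathcal M$: $\mathbb E_{V\leftarrow D}[T_2(P|_V,\alpha)]\le L_2\binom{N-k}{m}2^{Cr'}$. 3. (a) For every $\alpha\in\mathcal M$: $\mathbb E_{V\leftarrow D}[T_3(P|_V,\alpha,\alpha)]\le L_2\binom{N-k}{m}2^{Cr'}$. (b) For all distinct $\alpha,\alpha'\in\mathcal M$: $$\mathbb E_{V\leftarrow D}[T_3(P|_V,\alpha,\alpha')]\le L_2\binom{N-k}{m}2^{Cr'}\left(\left(\frac{m}{N-m}\right)^{k'}+\frac1{n^{(1-\tau)\nu}}\right)^{2r'-r}.$$ -/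

import Mathlib

open MvPolynomial
open scoped BigOperators

noncomputable section

namespace IMMSkew

/-! ### Polynomials over `Y ⊔ Z`: derivatives, `σ_Y`, `mult`, leading monomials -/

section General

variable {F : Type*} [Field F] {Yv Zv : Type*}

theorem pderiv_left_comm {σ : Type*} (i j : σ) (f : MvPolynomial σ F) :
    pderiv i (pderiv j f) = pderiv j (pderiv i f) := by
  classical
  have h : ⁅pderiv (R := F) i, pderiv (R := F) j⁆ = 0 := by
    apply MvPolynomial.derivation_ext
    intro l
    simp [Derivation.commutator_apply, pderiv_X, Pi.single_apply]
    split_ifs <;> simp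
  have h2 := congrArg (fun D => D f) h
  simpa [Derivation.commutator_apply, sub_eq_zero] using h2

instance pderivLeftCommutative {σ : Type*} :
    LeftCommutative (fun (i : σ) (f : MvPolynomial σ F) => pderiv i f) :=
  ⟨fun i j f => pderiv_left_comm i j f⟩

/-- `∂_α f`: the iterated partial derivative of `f` with respect to (all the variables, with
multiplicity, of) the monomial `α`. -/
def monomialDeriv {σ : Type*} (α : σ →₀ ℕ) (f : MvPolynomial σ F) : MvPolynomial σ F :=
  (Finsupp.toMultiset α).foldr (fun i g => pderiv i g) f

/-- `σ_Y`: set every `Y`-variable to zero and leave the `Z`-variables untouched. -/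
def sigmaY : MvPolynomial (Yv ⊕ Zv) F →ₐ[F] MvPolynomial Zv F :=
  aeval (Sum.elim (fun _ => 0) X)

/-- A monomial is multilinear if every exponent is at most one. -/
def IsMultilinear {σ : Type*} (s : σ →₀ ℕ) : Prop := ∀ i, s i ≤ 1

open Classical in
/-- `mult`: delete all the non-multilinear monomials. -/
def mult {σ : Type*} (f : MvPolynomial σ F) : MvPolynomial σ F :=
  ∑ s ∈ f.support with IsMultilinear s, monomial s (coeff s f)

/-- `M(α)`: the monomials in the support of `σ_Y(∂_α P)`. -/
def monoSet (P : MvPolynomial (Yv ⊕ Zv) F) (α : (Yv ⊕ Zv) →₀ ℕ) : Finset (Zv →₀ ℕ) :=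
  (sigmaY (monomialDeriv α P)).support

/-- `S_m(α, β)`: the monomials `γ` in the variables `W` with `deg γ = |supp γ| = m` whose support
is disjoint from that of `β`. -/
def setS (W : Finset Zv) (m : ℕ) (β : Zv →₀ ℕ) : Set (Zv →₀ ℕ) :=
  {γ | γ.support ⊆ W ∧ γ.degree = m ∧ γ.support.card = m ∧ Disjoint γ.support β.support}

/-- `A_m(α, β)`: the multilinear monomials `γ'` of degree `deg P - |α| + m` in the variables `W`
for which there is a monomial `γ` in the variables `W` with
`γ' = LM(mult(γ · σ_Y(∂_α P))) = γ · β`.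
Here `LM` is taken with respect to the monomial order `mo`. -/
def setA (mo : MonomialOrder Zv) (W : Finset Zv) (m : ℕ) (P : MvPolynomial (Yv ⊕ Zv) F)
    (α : (Yv ⊕ Zv) →₀ ℕ) (β : Zv →₀ ℕ) : Set (Zv →₀ ℕ) :=
  {γ' | γ'.support ⊆ W ∧ IsMultilinear γ' ∧ γ'.degree = P.totalDegree - α.degree + m ∧
    ∃ γ : Zv →₀ ℕ, γ.support ⊆ W ∧
      mult (monomial γ 1 * sigmaY (monomialDeriv α P)) ≠ 0 ∧
      γ' = mo.degree (mult (monomial γ 1 * sigmaY (monomialDeriv α P))) ∧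
      γ' = γ + β}

/-- `T₁(P, α) = ∑_{β ∈ M(α)} |S_m(α, β)|`. -/
def T1 (W : Finset Zv) (m : ℕ) (P : MvPolynomial (Yv ⊕ Zv) F) (α : (Yv ⊕ Zv) →₀ ℕ) : ℕ :=
  ∑ β ∈ monoSet P α, (setS W m β).ncard

open Classical in
/-- `T₂(P, α) = ∑_{β ≠ γ ∈ M(α)} |S_m(α, β) ∩ S_m(α, γ)|`. -/
def T2 (W : Finset Zv) (m : ℕ) (P : MvPolynomial (Yv ⊕ Zv) F) (α : (Yv ⊕ Zv) →₀ ℕ) : ℕ :=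
  ∑ p ∈ monoSet P α ×ˢ monoSet P α with p.1 ≠ p.2, (setS W m p.1 ∩ setS W m p.2).ncard

open Classical in
/-- `T₃(P, α, α') = ∑ |A_m(α, β) ∩ A_m(α', γ)|` over `β ∈ M(α)`, `γ ∈ M(α')` with
`(α, β) ≠ (α', γ)`. -/
def T3 (mo : MonomialOrder Zv) (W : Finset Zv) (m : ℕ) (P : MvPolynomial (Yv ⊕ Zv) F)
    (α α' : (Yv ⊕ Zv) →₀ ℕ) : ℕ :=
  ∑ p ∈ monoSet P α ×ˢ monoSet P α' with (α, p.1) ≠ (α', p.2),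
    (setA mo W m P α p.1 ∩ setA mo W m P α' p.2).ncard

end General

/-! ### Iterated matrix multiplication -/

/-- The variables `x_{p,q}^{(t)}` of `d` generic `n × n` matrices: `(t, p, q)`. -/
abbrev XVar (n d : ℕ) : Type := Fin d × Fin n × Fin n

/-- `IMM_{n,d}`: the sum over all `i_1, …, i_{d-1}` of
`x_{1,i_1}^{(1)} x_{i_1,i_2}^{(2)} ⋯ x_{i_{d-1},1}^{(d)}`. A choice of the indices is a walk
`p = (1, i_1, …, i_{d-1}, 1)`; the index `1` is `0 : Fin n` here. -/
def IMM (F : Type*) [Field F] (n d : ℕ) : MvPolynomial (XVar n d) F :=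
  ∑ p : Fin (d + 1) → Fin n with ((p 0 : ℕ) = 0 ∧ (p (Fin.last d) : ℕ) = 0),
    ∏ t : Fin d, X (t, p t.castSucc, p t.succ)

/-! ### The restrictions -/

/-- The variables `y^{(i)}_{p,q}`: `(i, p, q)`. -/
abbrev YVar (n r' : ℕ) : Type := Fin r' × Fin n × Fin n

/-- The half-blocks: `(i, false)` stands for `(i, L)` and `(i, true)` for `(i, R)`. -/
abbrev Half (r' : ℕ) : Type := Fin r' × Bool

/-- The `Z₀`-variables: `((i, b), j, p, q)` is the `(p, q)` entry of the matrix
`Z^{(i, b, j + 1)}`. -/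
abbrev ZVar (n r' k' : ℕ) : Type := Half r' × Fin k' × Fin n × Fin n

variable {n r' k' : ℕ}

/-- The deterministic restriction `V₀`. The `d = r' (2k' + 3)` matrices are cut into `r'`
contiguous blocks; the matrices of the block `i` are, at the positions `s = 0, …, 2k' + 2`,
`X^{(i,L,k'+1)}, …, X^{(i,L,1)}, X^{(i)}, X^{(i,R,1)}, …, X^{(i,R,k'+1)}`. -/
def detRestrict (F : Type*) [Field F] (x : XVar n (r' * (2 * k' + 3))) :
    MvPolynomial (YVar n r' ⊕ ZVar n r' k') F :=
  let i : Fin r' := (finProdFinEquiv.symm x.1).1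
  let s : ℕ := (finProdFinEquiv.symm x.1).2
  let p : Fin n := x.2.1
  let q : Fin n := x.2.2
  if s = 0 then (if (p : ℕ) = 0 then 1 else 0)
  else if s = 2 * k' + 2 then (if (q : ℕ) = 0 then 1 else 0)
  else if s = k' + 1 then X (Sum.inl (i, p, q))
  else if h : k' - s < k' ∧ s < k' + 1 then X (Sum.inr ((i, false), ⟨k' - s, h.1⟩, p, q))
  else if h' : s - (k' + 2) < k' then X (Sum.inr ((i, true), ⟨s - (k' + 2), h'⟩, p, q))
  else 0

/-- The number of entries kept alive in each column (left) or row (right) of the matrix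
`Z^{(i, b, j + 1)}`: `a` for the first matrix, `1` for the last `l` matrices, and `2` for the
matrices in between. -/
def numAlive (k' a l : ℕ) (j : Fin k') : ℕ :=
  if (j : ℕ) = 0 then a else if (j : ℕ) + 1 + l ≤ k' then 2 else 1

/-- The outcome of the random choices: for every half-block `(i, b)`, every `j` and every index
`v`, the set of positions kept alive in the column `v` (if `b = L`) or the row `v` (if `b = R`)
of `Z^{(i, b, j + 1)}`. -/
abbrev Choices (n r' k' : ℕ) : Type := Half r' × Fin k' × Fin n → Finset (Fin n)

/-- The support of the distribution `D`: all outcomes with the prescribed numbers of alive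
positions. `D` is the uniform distribution on this finite product, that is, all the choices are
uniform and mutually independent. -/
def restrictions (n r' k' a l : ℕ) : Finset (Choices n r' k') :=
  Fintype.piFinset fun c => Finset.univ.powersetCard (numAlive k' a l c.2.1)

open Classical in
/-- The set `Z` of the `Z₀`-variables that are left after the restriction. -/
def aliveVars (V : Choices n r' k') : Finset (ZVar n r' k') :=
  {z | if z.1.2 = true then z.2.2.2 ∈ V (z.1, z.2.1, z.2.2.1)
       else z.2.2.1 ∈ V (z.1, z.2.1, z.2.2.2)}

open Classical in
/-- The random restriction `V₁`: `Y`-variables and alive `Z₀`-variables are kept, the other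
`Z₀`-variables are set to zero. -/
def randRestrict (F : Type*) [Field F] (V : Choices n r' k') :
    YVar n r' ⊕ ZVar n r' k' → MvPolynomial (YVar n r' ⊕ ZVar n r' k') F
  | Sum.inl y => X (Sum.inl y)
  | Sum.inr z => if z ∈ aliveVars V then X (Sum.inr z) else 0

/-- `P|_V`: the polynomial `IMM_{n,d}`, `d = r' (2k' + 3)`, restricted by `V = V₁ ∘ V₀`. -/
def restrictedIMM (F : Type*) [Field F] (V : Choices n r' k') :
    MvPolynomial (YVar n r' ⊕ ZVar n r' k') F :=
  aeval (randRestrict F V) (aeval (detRestrict F) (IMM F n (r' * (2 * k' + 3))))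

/-- The monomial `∏_i y^{(i)}_{(a_{2i-1}, a_{2i})}` of a vector `(a_1, …, a_{2r'}) ∈ [n]^{2r'}`. -/
def yMonomial (k' : ℕ) (v : Fin (2 * r') → Fin n) : (YVar n r' ⊕ ZVar n r' k') →₀ ℕ :=
  ∑ i : Fin r',
    Finsupp.single (Sum.inl (i, v ⟨2 * i, by omega⟩, v ⟨2 * i + 1, by omega⟩)) 1

end IMMSkew

end

/-!
Restricted by `V`, the iterated matrix product factors over the blocks: the first row of the
product of the matrices of a block is concentrated in its first entry, which is
`∑ p, ∑ q, L p * y p q * R q`. Here `L p` and `R q` are the sums of the monomials of the alive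
paths that leave the row `p` of the middle matrix to the left and its column `q` to the right
(`restrictedIMM_eq_prod`). Hence `σ_Y(∂_α P)` is a product over the half-blocks of sums over paths
with a root prescribed by `α`. Different families of paths have different squarefree monomials of
degree `k`, so that `M(α)` is the set of these monomials (`monoSet_restrictedIMM`), and the exact
counts follow.

Let the monomials `β`, `γ` be such that `γ` has `t` variables outside `β`. Then
`|S_m(β) ∩ S_m(γ)| = (N - k - t).choose m`, which is at most `(N - k).choose m * x ^ t` with
`x = (N - m) / N`. An element of `A_m(α, β) ∩ A_m(α', γ)` is squarefree of degree `k + m` and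
divisible by both `β` and `γ`; already without the condition on leading monomials there are at most
`(N - k).choose m * x ^ t` of those, with `x = m / (N - k)`. So `T₂` and `T₃` are bounded by sums
of `x ^ t` over pairs of families of paths. Such a sum is a product over the half-blocks of sums
`pairSum` over pairs of paths, and its expectation is the product of the expectations, since the
half-blocks are independent.

For a single half-block, the expectation of `pairSum`, divided by the number of paths, is bounded by
a linear recursion over the layers (`pairBound`, `sum_pairSum_le`): paths that leave the same vertex
use the same edge or separate, paths that leave different vertices use different edges and meet
with probability about `1 / n` for each candidate. Since `2 x` is essentially at most `1 + Γ` and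
`(1 + Γ) ^ k' = 2 n ^ 0.29`, pairs that separate after the first layer contribute about
`n ^ (0.29 - 0.34)` per layer, and the `a` edges in the first layer, about `n ^ 0.05` in number,
bring the total to a constant. If the roots differ, pairs that never meet contribute
`a * x ^ k' * 2 ^ (k' - l - 1)`, a constant times `(m / (N - m)) ^ k'`, and those that meet
contribute at most about `n ^ (-0.65)`, which is less than the required power of `n`
(`pairBound_estimates`). At least `2 r' - r` half-blocks have different roots if `α ≠ α'`.
-/

namespace IMMSkew

/-! ### Squarefree monomials and the sizes of `S_m` and `A_m` -/

section Squarefree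

variable {σ : Type*}

/-- The squarefree monomial whose support is the finite set `s`. -/
noncomputable def sqfree (s : Finset σ) : σ →₀ ℕ := ∑ z ∈ s, Finsupp.single z 1

open Classical in
theorem sqfree_apply (s : Finset σ) (z : σ) : sqfree s z = if z ∈ s then 1 else 0 := by
  simp [sqfree, Finsupp.finsetSum_apply, Finsupp.single_apply]

@[simp] theorem support_sqfree (s : Finset σ) : (sqfree s).support = s := by
  classical
  ext z
  simp [sqfree_apply]

theorem degree_sqfree (s : Finset σ) : (sqfree s).degree = s.card := by
  simp [sqfree]

theorem sqfree_injective : Function.Injective (sqfree : Finset σ → σ →₀ ℕ) := fun s t h => by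
  rw [← support_sqfree s, h, support_sqfree]

theorem IsMultilinear.eq_sqfree {γ : σ →₀ ℕ} (h : IsMultilinear γ) : γ = sqfree γ.support := by
  classical
  ext z
  rw [sqfree_apply]
  have := h z
  split_ifs with hz
  · rw [Finsupp.mem_support_iff] at hz
    omega
  · simpa using hz

theorem eq_sqfree_of_degree {γ : σ →₀ ℕ} (h : γ.degree = γ.support.card) :
    γ = sqfree γ.support := by
  refine IsMultilinear.eq_sqfree fun z => ?_
  by_contra hz
  push Not at hz
  have hzs : z ∈ γ.support := by rw [Finsupp.mem_support_iff]; omega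
  have : γ.support.card < γ.degree := by
    rw [Finsupp.degree_apply, Finset.card_eq_sum_ones]
    refine Finset.sum_lt_sum (fun i hi => ?_) ⟨z, hzs, hz⟩
    rw [Finsupp.mem_support_iff] at hi
    omega
  omega

open Classical in
theorem setS_sqfree (W B : Finset σ) (m : ℕ) :
    setS W m (sqfree B) = sqfree '' ((W \ B).powersetCard m : Set (Finset σ)) := by
  ext γ
  simp only [setS, support_sqfree, Set.mem_ofPred_eq, Set.mem_image, Finset.mem_coe,
    Finset.mem_powersetCard, Finset.subset_sdiff]
  constructor
  · rintro ⟨h1, h2, h3, h4⟩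
    exact ⟨γ.support, ⟨⟨h1, h4⟩, h3⟩, (eq_sqfree_of_degree (h2.trans h3.symm)).symm⟩
  · rintro ⟨s, ⟨⟨h1, h4⟩, h3⟩, rfl⟩
    simp [degree_sqfree, *]

theorem ncard_sqfree_image (S : Finset (Finset σ)) :
    (sqfree '' (S : Set (Finset σ))).ncard = S.card := by
  rw [Set.ncard_image_of_injective _ sqfree_injective, Set.ncard_coe_finset]

theorem ncard_setS_sqfree {W B : Finset σ} (h : B ⊆ W) (m : ℕ) :
    (setS W m (sqfree B)).ncard = (W.card - B.card).choose m := by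
  classical
  rw [setS_sqfree, ncard_sqfree_image, Finset.card_powersetCard, Finset.card_sdiff_of_subset h]

open Classical in
theorem ncard_setS_inter {W B G : Finset σ} (hB : B ⊆ W) (hG : G ⊆ W) (m : ℕ) :
    (setS W m (sqfree B) ∩ setS W m (sqfree G)).ncard
      = (W.card - B.card - (G \ B).card).choose m := by
  have : (setS W m (sqfree B) ∩ setS W m (sqfree G))
      = sqfree '' ((W \ (B ∪ G)).powersetCard m : Set (Finset σ)) := by
    rw [setS_sqfree, setS_sqfree, ← Set.image_inter sqfree_injective, ← Finset.coe_inter]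
    congr 2
    ext s
    simp only [Finset.mem_inter, Finset.mem_powersetCard, Finset.subset_sdiff,
      Finset.disjoint_union_right]
    tauto
  rw [this, ncard_sqfree_image, Finset.card_powersetCard,
    Finset.card_sdiff_of_subset (Finset.union_subset hB hG), ← Finset.union_sdiff_self_eq_union,
    Finset.card_union_of_disjoint Finset.disjoint_sdiff, Nat.sub_sub]

/-- Elements of both `A_m(α, β)` and `A_m(α', γ)` are squarefree and divisible by both `β` and `γ`;
the condition on leading monomials is not needed for the upper bound. -/
theorem ncard_inter_le_of_divisible [DecidableEq σ] {W B G : Finset σ} {m : ℕ}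
    (hB : B ⊆ W) (hG : G ⊆ W) {A : Set (σ →₀ ℕ)}
    (hA : ∀ γ ∈ A, γ.support ⊆ W ∧ IsMultilinear γ ∧ γ.degree = B.card + m ∧
      B ⊆ γ.support ∧ G ⊆ γ.support) :
    A.ncard ≤ if (G \ B).card ≤ m then
      (W.card - B.card - (G \ B).card).choose (m - (G \ B).card) else 0 := by
  have hcard : (B ∪ G).card = B.card + (G \ B).card := by
    rw [← Finset.union_sdiff_self_eq_union, Finset.card_union_of_disjoint Finset.disjoint_sdiff]
  have hdeg : ∀ γ ∈ A, γ.support.card = B.card + m := fun γ hγ => by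
    obtain ⟨_, h2, h3, _⟩ := hA γ hγ
    rw [← h3]
    conv_rhs => rw [h2.eq_sqfree, degree_sqfree]
  split_ifs with ht
  · rw [Nat.sub_sub, ← hcard, ← Finset.card_sdiff_of_subset (Finset.union_subset hB hG),
      ← Finset.card_powersetCard, ← Set.ncard_coe_finset]
    refine Set.ncard_le_ncard_of_injOn (fun γ => γ.support \ (B ∪ G)) (fun γ hγ => ?_)
      (fun γ hγ γ' hγ' h => ?_) (Finset.finite_toSet _)
    · obtain ⟨h1, h2, h3, h4, h5⟩ := hA γ hγ
      have := hdeg γ hγ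
      rw [Finset.mem_coe, Finset.mem_powersetCard]
      refine ⟨Finset.sdiff_subset_sdiff h1 subset_rfl, ?_⟩
      rw [Finset.card_sdiff_of_subset (Finset.union_subset h4 h5)]
      omega
    · obtain ⟨h1, h2, h3, h4, h5⟩ := hA γ hγ
      obtain ⟨h1', h2', h3', h4', h5'⟩ := hA γ' hγ'
      rw [h2.eq_sqfree, h2'.eq_sqfree, ← Finset.sdiff_union_of_subset (Finset.union_subset h4 h5),
        ← Finset.sdiff_union_of_subset (Finset.union_subset h4' h5')]
      exact congrArg (fun s => sqfree (s ∪ (B ∪ G))) h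
  · rw [Nat.le_zero, Set.ncard_eq_zero (Set.Finite.subset (Set.Finite.image sqfree
      (Finset.finite_toSet W.powerset)) ?_)]
    · refine Set.eq_empty_of_forall_notMem fun γ hγ => ht ?_
      obtain ⟨h1, h2, h3, h4, h5⟩ := hA γ hγ
      have := hdeg γ hγ
      have := Finset.card_le_card (Finset.union_subset h4 h5)
      omega
    · intro γ hγ
      obtain ⟨h1, h2, _⟩ := hA γ hγ
      exact ⟨γ.support, by simpa using h1, h2.eq_sqfree.symm⟩

/-- Enlarging the forbidden set by one variable costs a factor `(N - m) / N`. -/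
theorem choose_sub_le (N k m t : ℕ) (hN : k + t ≤ N) (hm : m ≤ N) (hN0 : 0 < N) :
    (((N - k - t).choose m : ℕ) : ℝ)
      ≤ ((N - k).choose m : ℕ) * (((N : ℝ) - m) / N) ^ t := by
  induction t with
  | zero => simp
  | succ t ih =>
    have hx : 0 ≤ ((N : ℝ) - m) / N :=
      div_nonneg (sub_nonneg.2 (by exact_mod_cast hm)) (by positivity)
    have hstep : (((N - k - (t + 1)).choose m : ℕ) : ℝ)
        ≤ ((N - k - t).choose m : ℕ) * (((N : ℝ) - m) / N) := by
      obtain ⟨M, hM⟩ : ∃ M, N - k - t = M + 1 := ⟨N - k - t - 1, by omega⟩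
      have hM' : N - k - (t + 1) = M := by omega
      rw [hM, hM', ← mul_div_assoc, le_div_iff₀ (by positivity)]
      by_cases hmM : m ≤ M + 1
      · have h := Nat.choose_mul_succ_eq M m
        have h' : ((M.choose m : ℕ) : ℝ) * (M + 1)
            = ((M + 1).choose m : ℕ) * ((M : ℝ) + 1 - m) := by
          have := congrArg (Nat.cast : ℕ → ℝ) h
          rw [Nat.cast_mul, Nat.cast_mul, Nat.cast_sub hmM] at this
          push_cast at this
          exact this
        have hle : ((M.choose m : ℕ) : ℝ) ≤ ((M + 1).choose m : ℕ) := by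
          exact_mod_cast Nat.choose_le_choose m (Nat.le_succ M)
        have hMN : (M : ℝ) + 1 ≤ N := by
          have : M + 1 ≤ N := by omega
          exact_mod_cast this
        nlinarith
      · rw [Nat.choose_eq_zero_of_lt (by omega), Nat.choose_eq_zero_of_lt (by omega)]
        simp
    calc _ ≤ _ := hstep
      _ ≤ ((N - k).choose m : ℕ) * (((N : ℝ) - m) / N) ^ t * (((N : ℝ) - m) / N) := by
          gcongr
          exact ih (by omega)
      _ = _ := by ring

/-- Prescribing one more variable costs a factor `m / (N - k)`. -/
theorem choose_sub_sub_le (N k m t : ℕ) (hN : k + t ≤ N) (hm : m + k ≤ N) (ht : t ≤ m) :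
    (((N - k - t).choose (m - t) : ℕ) : ℝ)
      ≤ ((N - k).choose m : ℕ) * ((m : ℝ) / ((N : ℝ) - k)) ^ t := by
  have hNk : (0 : ℝ) ≤ (N : ℝ) - k := sub_nonneg.2 (by exact_mod_cast (by omega : k ≤ N))
  induction t with
  | zero => simp
  | succ t ih =>
    have hstep : (((N - k - (t + 1)).choose (m - (t + 1)) : ℕ) : ℝ)
        ≤ ((N - k - t).choose (m - t) : ℕ) * ((m : ℝ) / ((N : ℝ) - k)) := by
      obtain ⟨M, hM⟩ : ∃ M, N - k - t = M + 1 := ⟨N - k - t - 1, by omega⟩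
      obtain ⟨q, hq⟩ : ∃ q, m - t = q + 1 := ⟨m - t - 1, by omega⟩
      have hM' : N - k - (t + 1) = M := by omega
      have hq' : m - (t + 1) = q := by omega
      have hNkM : (N : ℝ) - k = M + 1 + t := by
        have : N = M + 1 + t + k := by omega
        rw [this]; push_cast; ring
      have hmq : (m : ℝ) = q + 1 + t := by
        have : m = q + 1 + t := by omega
        rw [this]; push_cast; ring
      have hqM : (q : ℝ) ≤ M := by exact_mod_cast (by omega : q ≤ M)
      rw [hM, hM', hq, hq', hNkM, hmq, ← mul_div_assoc, le_div_iff₀ (by positivity)]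
      have h : ((M : ℝ) + 1) * (M.choose q : ℕ) = ((M + 1).choose (q + 1) : ℕ) * ((q : ℝ) + 1) := by
        exact_mod_cast Nat.add_one_mul_choose_eq M q
      have hle : ((M.choose q : ℕ) : ℝ) ≤ ((M + 1).choose (q + 1) : ℕ) := by
        rw [Nat.choose_succ_succ]; push_cast; simp
      have ht0 : (0 : ℝ) ≤ t := by positivity
      nlinarith
    calc _ ≤ _ := hstep
      _ ≤ ((N - k).choose m : ℕ) * ((m : ℝ) / ((N : ℝ) - k)) ^ t * ((m : ℝ) / ((N : ℝ) - k)) := by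
          have : 0 ≤ ((m : ℝ) / ((N : ℝ) - k)) := by positivity
          gcongr
          exact ih (by omega) (by omega)
      _ = _ := by ring

end Squarefree

/-! ### Random layered paths -/

section Paths

variable {n : ℕ}

/-- The vertex that the path `w` starting at `u` leaves at its step `j`; the path visits
`u, w 0, w 1, …`. -/
def prevVertex {K : ℕ} (u : Fin n) (w : Fin K → Fin n) (j : Fin K) : Fin n :=
  (Fin.cons u w : Fin (K + 1) → Fin n) j.castSucc

@[simp] theorem prevVertex_cons_zero {K : ℕ} (u e : Fin n) (w : Fin K → Fin n) :
    prevVertex u (Fin.cons e w : Fin (K + 1) → Fin n) 0 = u := rfl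

@[simp] theorem prevVertex_cons_succ {K : ℕ} (u e : Fin n) (w : Fin K → Fin n) (j : Fin K) :
    prevVertex u (Fin.cons e w : Fin (K + 1) → Fin n) j.succ = prevVertex e w j := by
  simp [prevVertex]

/-- The paths from `u` in the layered graph in which the vertex `v` of the layer `j` has the set
`c j v` of out-neighbours. -/
def paths {K : ℕ} (c : Fin K → Fin n → Finset (Fin n)) (u : Fin n) : Finset (Fin K → Fin n) :=
  Finset.univ.filter fun w => ∀ j, w j ∈ c j (prevVertex u w j)

theorem mem_paths {K : ℕ} {c : Fin K → Fin n → Finset (Fin n)} {u : Fin n} {w : Fin K → Fin n} :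
    w ∈ paths c u ↔ ∀ j, w j ∈ c j (prevVertex u w j) := by simp [paths]

theorem cons_mem_paths {K : ℕ} {c : Fin (K + 1) → Fin n → Finset (Fin n)} {u e : Fin n}
    {w : Fin K → Fin n} :
    (Fin.cons e w : Fin (K + 1) → Fin n) ∈ paths c u ↔ e ∈ c 0 u ∧ w ∈ paths (Fin.tail c) e := by
  simp [mem_paths, Fin.forall_fin_succ, Fin.tail]

theorem sum_paths_zero {M : Type*} [AddCommMonoid M] (c : Fin 0 → Fin n → Finset (Fin n))
    (u : Fin n) (f : (Fin 0 → Fin n) → M) : ∑ w ∈ paths c u, f w = f Fin.elim0 := by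
  have : paths c u = {Fin.elim0} := by
    ext w
    simp [mem_paths, Subsingleton.elim w Fin.elim0]
  rw [this, Finset.sum_singleton]

theorem sum_paths_succ {M : Type*} [AddCommMonoid M] {K : ℕ}
    (c : Fin (K + 1) → Fin n → Finset (Fin n)) (u : Fin n) (f : (Fin (K + 1) → Fin n) → M) :
    ∑ w ∈ paths c u, f w = ∑ e ∈ c 0 u, ∑ w ∈ paths (Fin.tail c) e, f (Fin.cons e w) := by
  rw [Finset.sum_sigma']
  refine Finset.sum_bij' (fun w _ => ⟨w 0, Fin.tail w⟩) (fun p _ => Fin.cons p.1 p.2)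
    (fun w hw => ?_) (fun p hp => ?_) (fun w _ => Fin.cons_self_tail w) (fun p _ => by simp)
    (fun w _ => by simp)
  · rw [Finset.mem_sigma, ← cons_mem_paths]
    simpa using hw
  · rw [Finset.mem_sigma] at hp
    exact cons_mem_paths.2 hp

theorem card_paths {K : ℕ} {c : Fin K → Fin n → Finset (Fin n)} {g : Fin K → ℕ}
    (hc : ∀ j v, (c j v).card = g j) (u : Fin n) : (paths c u).card = ∏ j, g j := by
  induction K generalizing u with
  | zero =>
    rw [Finset.card_eq_sum_ones, sum_paths_zero]
    simp
  | succ K ih =>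
    rw [Finset.card_eq_sum_ones, sum_paths_succ, Fin.prod_univ_succ, ← hc 0 u,
      Finset.card_eq_sum_ones (c 0 u), Finset.sum_mul]
    refine Finset.sum_congr rfl fun e _ => ?_
    rw [← Finset.card_eq_sum_ones, ih (c := Fin.tail c) (g := fun j => g j.succ)
      (fun j v => hc j.succ v), one_mul]

/-- The sum, over all pairs of a path from `u` and a path from `u'`, of `x` to the power the number
of steps at which the two paths use different edges. -/
noncomputable def pairSum (x : ℝ) {K : ℕ} (c : Fin K → Fin n → Finset (Fin n)) (u u' : Fin n) : ℝ :=
  ∑ w ∈ paths c u, ∑ w' ∈ paths c u',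
    ∏ j, if prevVertex u w j = prevVertex u' w' j ∧ w j = w' j then 1 else x

theorem pairSum_zero (x : ℝ) (c : Fin 0 → Fin n → Finset (Fin n)) (u u' : Fin n) :
    pairSum x c u u' = 1 := by
  rw [pairSum, sum_paths_zero, sum_paths_zero]
  simp

theorem pairSum_succ (x : ℝ) {K : ℕ} (c : Fin (K + 1) → Fin n → Finset (Fin n)) (u u' : Fin n) :
    pairSum x c u u' = ∑ e ∈ c 0 u, ∑ e' ∈ c 0 u',
      (if u = u' ∧ e = e' then 1 else x) * pairSum x (Fin.tail c) e e' := by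
  rw [pairSum, sum_paths_succ]
  refine Finset.sum_congr rfl fun e _ => ?_
  simp_rw [sum_paths_succ]
  rw [Finset.sum_comm]
  refine Finset.sum_congr rfl fun e' _ => ?_
  rw [pairSum, Finset.mul_sum]
  refine Finset.sum_congr rfl fun w _ => ?_
  rw [Finset.mul_sum]
  refine Finset.sum_congr rfl fun w' _ => ?_
  simp [Fin.prod_univ_succ]

/-- All choices of out-neighbourhoods for one half-block, with `g j` neighbours in the layer `j`. -/
def halfChoices (n : ℕ) {K : ℕ} (g : Fin K → ℕ) : Finset (Fin K → Fin n → Finset (Fin n)) :=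
  Fintype.piFinset fun j => Fintype.piFinset fun _ => Finset.univ.powersetCard (g j)

/-- All choices of out-neighbourhoods for one layer. -/
def layerChoices (n g : ℕ) : Finset (Fin n → Finset (Fin n)) :=
  Fintype.piFinset fun _ => Finset.univ.powersetCard g

theorem mem_halfChoices {K : ℕ} {g : Fin K → ℕ} {c : Fin K → Fin n → Finset (Fin n)} :
    c ∈ halfChoices n g ↔ ∀ j v, (c j v).card = g j := by
  simp [halfChoices, Fintype.mem_piFinset, Finset.mem_powersetCard]

theorem mem_layerChoices {g : ℕ} {c : Fin n → Finset (Fin n)} :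
    c ∈ layerChoices n g ↔ ∀ v, (c v).card = g := by
  simp [layerChoices, Fintype.mem_piFinset, Finset.mem_powersetCard]

theorem sum_halfChoices_succ {M : Type*} [AddCommMonoid M] {K : ℕ} (g : Fin (K + 1) → ℕ)
    (f : (Fin (K + 1) → Fin n → Finset (Fin n)) → M) :
    ∑ c ∈ halfChoices n g, f c
      = ∑ c₀ ∈ layerChoices n (g 0), ∑ c ∈ halfChoices n (fun j => g j.succ),
          f (Fin.cons c₀ c) := by
  rw [← Finset.sum_product']
  refine Finset.sum_bij' (fun w _ => (w 0, Fin.tail w)) (fun p _ => Fin.cons p.1 p.2)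
    (fun w hw => ?_) (fun p hp => ?_) (fun w _ => Fin.cons_self_tail w) (fun p _ => by simp)
    (fun w _ => by simp)
  · rw [mem_halfChoices] at hw
    rw [Finset.mem_product, mem_halfChoices, mem_layerChoices]
    exact ⟨hw 0, fun j => hw j.succ⟩
  · rw [Finset.mem_product, mem_halfChoices, mem_layerChoices] at hp
    rw [mem_halfChoices, Fin.forall_fin_succ]
    simpa using hp

theorem card_halfChoices_succ {K : ℕ} (g : Fin (K + 1) → ℕ) :
    (halfChoices n g).card
      = (layerChoices n (g 0)).card * (halfChoices n (fun j => g j.succ)).card := by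
  rw [Finset.card_eq_sum_ones, sum_halfChoices_succ]
  simp

/-- A uniformly random `g`-subset of `Fin n` contains a given element with probability `g / n`. -/
theorem sum_powersetCard_indicator_mem (g : ℕ) (e : Fin n) :
    (∑ s ∈ (Finset.univ : Finset (Fin n)).powersetCard g, if e ∈ s then (1 : ℝ) else 0)
      = (g / n : ℝ) * (Finset.powersetCard g (Finset.univ : Finset (Fin n))).card := by
  have hn : (n : ℝ) ≠ 0 := by
    have := e.pos
    positivity
  have hsymm : ∀ e' : Fin n,
      (∑ s ∈ (Finset.univ : Finset (Fin n)).powersetCard g, if e' ∈ s then (1 : ℝ) else 0)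
      = ∑ s ∈ (Finset.univ : Finset (Fin n)).powersetCard g, if e ∈ s then (1 : ℝ) else 0 := by
    intro e'
    refine Finset.sum_equiv (Equiv.finsetCongr (Equiv.swap e e')) (fun s => ?_) (fun s _ => ?_)
    · simp [Finset.mem_powersetCard]
    · simp
  have htot : ∑ e' : Fin n,
      (∑ s ∈ (Finset.univ : Finset (Fin n)).powersetCard g, if e' ∈ s then (1 : ℝ) else 0)
      = g * (Finset.powersetCard g (Finset.univ : Finset (Fin n))).card := by
    rw [Finset.sum_comm, Finset.sum_congr rfl (g := fun _ => (g : ℝ))]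
    · simp [mul_comm]
    · intro s hs
      rw [Finset.mem_powersetCard] at hs
      simp [hs.2]
  rw [Finset.sum_congr rfl fun e' _ => hsymm e'] at htot
  simp only [Finset.sum_const, Finset.card_univ, Fintype.card_fin, nsmul_eq_mul] at htot
  field_simp
  linarith

/-- Two different vertices of a random layer have `g ^ 2 / n` common out-neighbours on average. -/
theorem sum_layerChoices_card_inter (g : ℕ) {u u' : Fin n} (h : u ≠ u') :
    (∑ c ∈ layerChoices n g, ((c u ∩ c u').card : ℝ))
      = (g : ℝ) ^ 2 / n * (layerChoices n g).card := by
  have hn : (n : ℝ) ≠ 0 := by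
    have := u.pos
    positivity
  have key : ∀ e : Fin n, (∑ c ∈ layerChoices n g, if e ∈ c u ∩ c u' then (1 : ℝ) else 0)
      = (g / n : ℝ) ^ 2 * (layerChoices n g).card := by
    intro e
    have h1 : ∀ c : Fin n → Finset (Fin n), (if e ∈ c u ∩ c u' then (1 : ℝ) else 0)
        = ∏ v, if v = u ∨ v = u' then (if e ∈ c v then (1 : ℝ) else 0) else 1 := by
      intro c
      rw [Finset.prod_ite, Finset.prod_const_one, mul_one,
        show (Finset.univ.filter fun v => v = u ∨ v = u') = {u, u'} by ext; simp,
        Finset.prod_pair h]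
      by_cases h1 : e ∈ c u <;> by_cases h2 : e ∈ c u' <;> simp [h1, h2]
    rw [Finset.sum_congr rfl fun c _ => h1 c, layerChoices,
      ← Finset.prod_univ_sum (fun _ => Finset.univ.powersetCard g)
        (fun v s => if v = u ∨ v = u' then (if e ∈ s then (1 : ℝ) else 0) else 1)]
    have h2 : ∀ v : Fin n, (∑ s ∈ (Finset.univ : Finset (Fin n)).powersetCard g,
        if v = u ∨ v = u' then (if e ∈ s then (1 : ℝ) else 0) else 1)
        = (if v = u ∨ v = u' then (g / n : ℝ) else 1)
          * (Finset.powersetCard g (Finset.univ : Finset (Fin n))).card := by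
      intro v
      split_ifs
      · exact sum_powersetCard_indicator_mem g e
      · simp
    rw [Finset.prod_congr rfl fun v _ => h2 v, Finset.prod_mul_distrib, Fintype.card_piFinset,
      Nat.cast_prod, Finset.prod_ite, Finset.prod_const_one, mul_one,
      show (Finset.univ.filter fun v => v = u ∨ v = u') = {u, u'} by ext; simp,
      Finset.prod_pair h, sq]
  have h3 : ∀ c : Fin n → Finset (Fin n), ((c u ∩ c u').card : ℝ)
      = ∑ e, if e ∈ c u ∩ c u' then (1 : ℝ) else 0 := by
    intro c
    rw [Finset.sum_ite_mem, Finset.univ_inter]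
    simp
  rw [Finset.sum_congr rfl fun c _ => h3 c, Finset.sum_comm, Finset.sum_congr rfl fun e _ => key e]
  simp only [Finset.sum_const, Finset.card_univ, Fintype.card_fin, nsmul_eq_mul]
  field_simp

/-- The pair `(α_K, β_K)` bounding the normalized expectation of `pairSum` for `K` layers: `α_K` for
paths with a common root, `β_K` for paths with different roots. Here `G s` is the number of
out-neighbours of a vertex after whose step `s` layers remain. -/
noncomputable def pairBound (x : ℝ) (n : ℕ) (G : ℕ → ℕ) : ℕ → ℝ × ℝ
  | 0 => (1, 1)
  | K + 1 => ((pairBound x n G K).1 + ((G K : ℝ) - 1) * x * (pairBound x n G K).2,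
      x * G K * ((pairBound x n G K).1 / n + (pairBound x n G K).2))

theorem pairBound_nonneg {x : ℝ} (hx : 0 ≤ x) (n : ℕ) {G : ℕ → ℕ} (hG : ∀ s, 1 ≤ G s) (K : ℕ) :
    0 ≤ (pairBound x n G K).1 ∧ 0 ≤ (pairBound x n G K).2 := by
  induction K with
  | zero => simp [pairBound]
  | succ K ih =>
    obtain ⟨h1, h2⟩ := ih
    have : (0 : ℝ) ≤ (G K : ℝ) - 1 := sub_nonneg.2 (by exact_mod_cast hG K)
    constructor <;> simp only [pairBound] <;> positivity

/-- Expected value of `pairSum`, by peeling off the first layer: two paths that leave different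
vertices use different edges, and meet again with probability about `1 / n` per candidate. -/
theorem sum_pairSum_le {x : ℝ} (hx : 0 ≤ x) {G : ℕ → ℕ} (hG : ∀ s, 1 ≤ G s) (K : ℕ)
    (u u' : Fin n) :
    ∑ c ∈ halfChoices n (fun j : Fin K => G j.rev), pairSum x c u u'
      ≤ (halfChoices n (fun j : Fin K => G j.rev)).card * ((∏ j : Fin K, (G j.rev : ℝ))
        * if u = u' then (pairBound x n G K).1 else (pairBound x n G K).2) := by
  induction K generalizing u u' with
  | zero => simp [pairSum_zero, pairBound]
  | succ K ih =>
    obtain ⟨hα, hβ⟩ := pairBound_nonneg hx n hG K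
    have hrev0 : ((0 : Fin (K + 1)).rev : ℕ) = K := by simp
    have hrevs : ∀ j : Fin K, ((j.succ).rev : ℕ) = j.rev := fun j => by
      simp
    rw [sum_halfChoices_succ, card_halfChoices_succ, Fin.prod_univ_succ]
    simp only [hrev0, hrevs]
    set H : ℝ := ((halfChoices n (fun j : Fin K => G j.rev)).card : ℝ) with hH
    set P : ℝ := ∏ j : Fin K, (G j.rev : ℝ) with hP
    set α := (pairBound x n G K).1 with hαdef
    set β := (pairBound x n G K).2 with hβdef
    have hH0 : 0 ≤ H := by positivity
    have hP0 : 0 ≤ P := by positivity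
    have hGK : (0 : ℝ) ≤ (G K : ℝ) - 1 := sub_nonneg.2 (by exact_mod_cast hG K)
    -- the first layer is fixed, the others are averaged
    have step : ∀ c₀ : Fin n → Finset (Fin n),
        ∑ c ∈ halfChoices n (fun j : Fin K => G j.rev),
          pairSum x (Fin.cons c₀ c : Fin (K + 1) → Fin n → Finset (Fin n)) u u'
        ≤ ∑ e ∈ c₀ u, ∑ e' ∈ c₀ u', (if u = u' ∧ e = e' then 1 else x) *
            (H * (P * if e = e' then α else β)) := by
      intro c₀
      simp_rw [pairSum_succ, Fin.cons_zero, Fin.tail_cons]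
      rw [Finset.sum_comm]
      refine Finset.sum_le_sum fun e _ => ?_
      rw [Finset.sum_comm]
      refine Finset.sum_le_sum fun e' _ => ?_
      rw [← Finset.mul_sum]
      refine mul_le_mul_of_nonneg_left (ih e e') ?_
      split_ifs <;> [exact zero_le_one; exact hx]
    refine (Finset.sum_le_sum fun c₀ _ => step c₀).trans ?_
    by_cases huu : u = u'
    · subst huu
      have : ∀ c₀ ∈ layerChoices n (G K),
          ∑ e ∈ c₀ u, ∑ e' ∈ c₀ u, (if u = u ∧ e = e' then 1 else x) *
            (H * (P * if e = e' then α else β))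
          = H * (G K * P * (α + ((G K : ℝ) - 1) * x * β)) := by
        intro c₀ hc₀
        rw [mem_layerChoices] at hc₀
        have inner : ∀ e ∈ c₀ u, ∑ e' ∈ c₀ u, (if u = u ∧ e = e' then 1 else x) *
            (H * (P * if e = e' then α else β))
            = H * P * (α + ((G K : ℝ) - 1) * x * β) := by
          intro e he
          rw [← Finset.add_sum_erase _ _ he, Finset.sum_congr rfl
            (g := fun _ => x * (H * (P * β)))]
          · rw [Finset.sum_const, Finset.card_erase_of_mem he, hc₀ u, nsmul_eq_mul,
              Nat.cast_sub (hG K)]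
            simp
            ring
          · intro e' he'
            simp [(Finset.ne_of_mem_erase he').symm]
        rw [Finset.sum_congr rfl inner, Finset.sum_const, hc₀ u, nsmul_eq_mul]
        ring
      rw [Finset.sum_congr rfl this, Finset.sum_const, nsmul_eq_mul]
      simp only [if_true, pairBound]
      apply le_of_eq
      push_cast
      ring
    · have : ∀ c₀ ∈ layerChoices n (G K),
          ∑ e ∈ c₀ u, ∑ e' ∈ c₀ u', (if u = u' ∧ e = e' then 1 else x) *
            (H * (P * if e = e' then α else β))
          ≤ x * H * P * α * (c₀ u ∩ c₀ u').card + x * H * P * β * (G K) ^ 2 := by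
        intro c₀ hc₀
        rw [mem_layerChoices] at hc₀
        have inner : ∀ e ∈ c₀ u, ∑ e' ∈ c₀ u', (if u = u' ∧ e = e' then 1 else x) *
            (H * (P * if e = e' then α else β))
            ≤ x * H * P * α * (if e ∈ c₀ u' then 1 else 0) + x * H * P * β * G K := by
          intro e _
          have hle : ∀ e' ∈ c₀ u', (if u = u' ∧ e = e' then 1 else x) *
              (H * (P * if e = e' then α else β))
              ≤ (if e = e' then x * H * P * α else 0) + x * H * P * β := by
            intro e' _
            have : 0 ≤ x * H * P * β := by positivity
            by_cases hee : e = e'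
            · simp only [huu, hee, false_and, if_false, if_true]
              linarith [show x * (H * (P * α)) = x * H * P * α by ring]
            · simp only [huu, hee, false_and, if_false]
              exact le_of_eq (by ring)
          refine (Finset.sum_le_sum hle).trans (le_of_eq ?_)
          rw [Finset.sum_add_distrib, Finset.sum_ite_eq, Finset.sum_const, hc₀ u', nsmul_eq_mul]
          split_ifs <;> ring
        refine (Finset.sum_le_sum inner).trans (le_of_eq ?_)
        rw [Finset.sum_add_distrib, ← Finset.mul_sum, Finset.sum_const, hc₀ u, nsmul_eq_mul,
          Finset.sum_ite_mem]
        simp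
        ring
      refine (Finset.sum_le_sum this).trans (le_of_eq ?_)
      rw [Finset.sum_add_distrib, ← Finset.mul_sum, sum_layerChoices_card_inter _ huu,
        Finset.sum_const, nsmul_eq_mul]
      simp only [if_neg huu, pairBound]
      push_cast
      ring

end Paths

/-! ### The restricted polynomial as a product over blocks -/

section Walks

variable {n : ℕ} {R : Type*} [CommRing R]

/-- The sum of the weights of all walks from `x` to `y` is an entry of the matrix product. -/
theorem sum_walks_eq_prod {d : ℕ} (M : Fin d → Matrix (Fin n) (Fin n) R) (x y : Fin n) :
    ∑ p : Fin (d + 1) → Fin n with (p 0 = x ∧ p (Fin.last d) = y),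
      ∏ t : Fin d, M t (p t.castSucc) (p t.succ) = (List.ofFn M).prod x y := by
  induction d generalizing x with
  | zero =>
    simp only [Finset.univ_eq_empty, Finset.prod_empty, List.ofFn_zero, List.prod_nil]
    rw [Matrix.one_apply]
    split_ifs with h
    · subst h
      rw [Finset.sum_const, show (Finset.univ.filter fun p : Fin (0 + 1) → Fin n =>
        p 0 = x ∧ p (Fin.last 0) = x) = {fun _ => x} from ?_]
      · simp
      · ext p
        simp only [Finset.mem_filter, Finset.mem_univ, true_and, Finset.mem_singleton]
        constructor
        · intro hp
          funext i
          rw [show i = 0 from Subsingleton.elim (α := Fin 1) i 0]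
          exact hp.1
        · rintro rfl
          simp
    · rw [Finset.filter_false_of_mem, Finset.sum_empty]
      rintro p _ ⟨h1, h2⟩
      exact h (h1.symm.trans h2)
  | succ d ih =>
    rw [List.ofFn_succ, List.prod_cons, Matrix.mul_apply, Finset.sum_filter,
      ← (Fin.consEquiv fun _ : Fin (d + 2) => Fin n).sum_comp, Fintype.sum_prod_type,
      Finset.sum_eq_single x]
    · rw [← Finset.sum_congr rfl fun z _ => congrArg (M 0 x z * ·) (ih (fun t => M t.succ) z)]
      simp_rw [Finset.mul_sum, Finset.sum_filter]
      rw [Finset.sum_comm]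
      refine Finset.sum_congr rfl fun p _ => ?_
      rw [Finset.sum_eq_single (p 0)]
      · simp [Fin.consEquiv, Fin.prod_univ_succ, ← Fin.succ_last]
      · intro z _ hz
        rw [if_neg fun h => hz h.1.symm]
      · simp
    · intro z _ hz
      refine Finset.sum_eq_zero fun p _ => if_neg fun h => hz ?_
      simpa [Fin.consEquiv] using h.1
    · simp

/-- The sum of the weights of the walks of length `s` that start at the vertex `u` of the layer
`j`. -/
def layerSum (A : ℕ → Fin n → Fin n → R) : ℕ → ℕ → Fin n → R
  | 0, _, _ => 1
  | s + 1, j, u => ∑ e, A j u e * layerSum A s (j + 1) e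

theorem layerSum_eq_sum_paths {A : ℕ → Fin n → Fin n → R} {K : ℕ}
    {c : Fin K → Fin n → Finset (Fin n)} {f : Fin K → Fin n → Fin n → R} {j : ℕ}
    (hA : ∀ (i : Fin K) u e, A (j + i) u e = if e ∈ c i u then f i u e else 0) (u : Fin n) :
    layerSum A K j u = ∑ w ∈ paths c u, ∏ i, f i (prevVertex u w i) (w i) := by
  induction K generalizing j u with
  | zero =>
    rw [layerSum, sum_paths_zero, Finset.univ_eq_empty, Finset.prod_empty]
  | succ K ih =>
    rw [layerSum, sum_paths_succ, ← Finset.sum_filter_add_sum_filter_not Finset.univ (· ∈ c 0 u)]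
    rw [Finset.sum_eq_zero (s := Finset.univ.filter (· ∉ c 0 u)), add_zero,
      Finset.filter_mem_eq_inter, Finset.univ_inter]
    · refine Finset.sum_congr rfl fun e he => ?_
      have h0 := hA 0 u e
      rw [if_pos he] at h0
      rw [show A j u e = f 0 u e by simpa using h0,
        ih (c := Fin.tail c) (f := fun i => f i.succ) (j := j + 1), Finset.mul_sum]
      · refine Finset.sum_congr rfl fun w _ => ?_
        simp [Fin.prod_univ_succ]
      · intro i u e
        have h1 := hA i.succ u e
        rwa [Fin.val_succ, add_comm (i : ℕ) 1, ← add_assoc] at h1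
    · intro e he
      rw [Finset.mem_filter] at he
      have h0 := hA 0 u e
      rw [if_neg he.2] at h0
      rw [show A j u e = 0 by simpa using h0, zero_mul]

/-- The product of the matrices of one block: its row `o` is concentrated in the column `o`,
where it is the sum over the entries of the middle matrix, weighted by the walks that leave its
row to the left and its column to the right. -/
theorem block_prod {K : ℕ} (o : Fin n) {M : ℕ → Matrix (Fin n) (Fin n) R}
    {A B : ℕ → Fin n → Fin n → R} {Y : Fin n → Fin n → R}
    (h0 : ∀ q, M 0 o q = 1) (hA : ∀ s < K, ∀ p q, M (s + 1) p q = A (K - 1 - s) q p)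
    (hY : ∀ p q, M (K + 1) p q = Y p q) (hB : ∀ s < K, ∀ p q, M (K + 2 + s) p q = B s p q)
    (hlast : ∀ p q, M (2 * K + 2) p q = if q = o then 1 else 0) (q : Fin n) :
    ((List.range (2 * K + 3)).map M).prod o q =
      if q = o then ∑ p, ∑ q, layerSum A K 0 p * Y p q * layerSum B K 0 q else 0 := by
  set v : ℕ → Fin n → R := fun s => ((List.range s).map M).prod o with hv
  have hstep : ∀ s q, v (s + 1) q = ∑ p, v s p * M s p q := fun s q => by
    simp only [hv, List.prod_range_succ, Matrix.mul_apply]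
  have hleft : ∀ s ≤ K, ∀ p, v (s + 1) p = layerSum A s (K - s) p := by
    intro s
    induction s with
    | zero =>
      intro _ p
      simp [hv, layerSum, h0]
    | succ s ih =>
      intro hs p
      rw [hstep, layerSum]
      refine Finset.sum_congr rfl fun e _ => ?_
      rw [ih (by omega), hA s (by omega), show K - (s + 1) = K - 1 - s by omega,
        show K - 1 - s + 1 = K - s by omega, mul_comm]
  have hright : ∀ s ≤ K, ∑ p, v (K + 2 + s) p * layerSum B (K - s) s p
      = ∑ p, v (K + 2) p * layerSum B K 0 p := by
    intro s
    induction s with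
    | zero => intro _; rfl
    | succ s ih =>
      intro hs
      rw [← ih (by omega), show K - s = (K - (s + 1)) + 1 by omega]
      simp only [layerSum, Finset.mul_sum]
      rw [Finset.sum_comm]
      refine Finset.sum_congr rfl fun e _ => ?_
      rw [show K + 2 + (s + 1) = K + 2 + s + 1 by ring, hstep, Finset.sum_mul]
      refine Finset.sum_congr rfl fun p _ => ?_
      rw [hB s (by omega), mul_assoc]
  change v (2 * K + 2 + 1) q = _
  rw [hstep]
  split_ifs with hq
  · have h1 := hright K le_rfl
    rw [show K + 2 + K = 2 * K + 2 by ring, Nat.sub_self] at h1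
    simp only [hlast, hq, if_true, mul_one]
    simp only [layerSum, mul_one] at h1
    rw [h1, Finset.sum_comm]
    refine Finset.sum_congr rfl fun q _ => ?_
    rw [hstep (K + 1), Finset.sum_mul]
    refine Finset.sum_congr rfl fun p _ => ?_
    rw [hleft K le_rfl, hY, Nat.sub_self]
  · simp [hlast, hq]

/-- If the row `o` of every factor vanishes off the diagonal, then the diagonal entry of the product
is the product of the diagonal entries. -/
theorem prod_apply_of_row (o : Fin n) (L : List (Matrix (Fin n) (Fin n) R))
    (hL : ∀ B ∈ L, ∀ q, q ≠ o → B o q = 0) : L.prod o o = (L.map fun B => B o o).prod := by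
  induction L with
  | nil => simp
  | cons B L ih =>
    rw [List.prod_cons, Matrix.mul_apply, Finset.sum_eq_single o, List.map_cons, List.prod_cons,
      ih fun B' hB' => hL B' (List.mem_cons_of_mem _ hB')]
    · intro q _ hq
      rw [hL B List.mem_cons_self q hq, zero_mul]
    · simp

theorem ofFn_finProdFinEquiv {α : Type*} {a b : ℕ} (f : Fin a → Fin b → α) :
    (List.ofFn fun t : Fin (a * b) => f (finProdFinEquiv.symm t).1 (finProdFinEquiv.symm t).2)
      = (List.ofFn fun i => List.ofFn fun j => f i j).flatten := by
  rw [List.ofFn_mul]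
  congr 2
  funext i
  congr 1
  funext j
  have : ∀ h, (⟨i * b + j, h⟩ : Fin (a * b)) = finProdFinEquiv (i, j) := fun h => by
    apply Fin.ext
    simp
    ring
  rw [this, Equiv.symm_apply_apply]

end Walks

section Restricted

variable {n r' k' : ℕ} (F : Type*) [Field F]

/-- The variable on the edge from the vertex `u` to the vertex `e` in the layer `j` of the
half-block `h`: paths run away from the middle matrix of the block, that is, from columns to rows
in the left half and from rows to columns in the right half. -/
def edgeVar (h : Half r') (j : Fin k') (u e : Fin n) : ZVar n r' k' :=
  (h, j, if h.2 = true then (u, e) else (e, u))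

theorem edgeVar_inj {h h' : Half r'} {j j' : Fin k'} {u u' e e' : Fin n} :
    edgeVar h j u e = edgeVar h' j' u' e' ↔ h = h' ∧ j = j' ∧ u = u' ∧ e = e' := by
  constructor
  · intro H
    simp only [edgeVar, Prod.mk.injEq] at H
    obtain ⟨rfl, rfl, H⟩ := H
    split_ifs at H <;> simp_all
  · rintro ⟨rfl, rfl, rfl, rfl⟩
    rfl

/-- The out-neighbourhoods in the half-block `h` given by the choices `V`. -/
def halfOf (V : Choices n r' k') (h : Half r') : Fin k' → Fin n → Finset (Fin n) :=
  fun j v => V (h, j, v)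

theorem edgeVar_mem_aliveVars {V : Choices n r' k'} {h : Half r'} {j : Fin k'} {u e : Fin n} :
    edgeVar h j u e ∈ aliveVars V ↔ e ∈ halfOf V h j u := by
  obtain ⟨i, b⟩ := h
  cases b <;> simp [edgeVar, aliveVars, halfOf]

/-- The sum of the monomials of the paths from `u` in the half-block `h`. -/
noncomputable def halfPoly (V : Choices n r' k') (h : Half r') (u : Fin n) :
    MvPolynomial (ZVar n r' k') F :=
  ∑ w ∈ paths (halfOf V h) u, ∏ j, X (edgeVar h j (prevVertex u w j) (w j))

/-- The entry `(p, q)` of the restriction of the matrix at the position `s` of the block `i`. -/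
noncomputable def blockMatrix (V : Choices n r' k') (i : Fin r') (s : ℕ) :
    Matrix (Fin n) (Fin n) (MvPolynomial (YVar n r' ⊕ ZVar n r' k') F) := fun p q =>
  aeval (randRestrict F V) (
    if s = 0 then (if (p : ℕ) = 0 then 1 else 0)
    else if s = 2 * k' + 2 then (if (q : ℕ) = 0 then 1 else 0)
    else if s = k' + 1 then X (Sum.inl (i, p, q))
    else if h : k' - s < k' ∧ s < k' + 1 then X (Sum.inr ((i, false), ⟨k' - s, h.1⟩, p, q))
    else if h' : s - (k' + 2) < k' then X (Sum.inr ((i, true), ⟨s - (k' + 2), h'⟩, p, q))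
    else 0 : MvPolynomial (YVar n r' ⊕ ZVar n r' k') F)

/-- The weight of the edge from `u` to `e` in the layer `j` of the half-block `h`. -/
noncomputable def edgeWeight (V : Choices n r' k') (h : Half r') (j : ℕ) (u e : Fin n) :
    MvPolynomial (YVar n r' ⊕ ZVar n r' k') F :=
  if hj : j < k' then if e ∈ halfOf V h ⟨j, hj⟩ u then X (Sum.inr (edgeVar h ⟨j, hj⟩ u e)) else 0
  else 0

theorem layerSum_edgeWeight (V : Choices n r' k') (h : Half r') (u : Fin n) :
    layerSum (edgeWeight F V h) k' 0 u = rename Sum.inr (halfPoly F V h u) := by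
  rw [layerSum_eq_sum_paths (c := halfOf V h) (f := fun j u e => X (Sum.inr (edgeVar h j u e)))]
  · simp [halfPoly]
  · intro i u e
    simp [edgeWeight]

theorem aeval_randRestrict_edgeVar (V : Choices n r' k') (h : Half r') (j : Fin k')
    (u e : Fin n) :
    aeval (randRestrict F V) (X (Sum.inr (edgeVar h j u e)) :
      MvPolynomial (YVar n r' ⊕ ZVar n r' k') F) = edgeWeight F V h j u e := by
  simp [edgeWeight, randRestrict, edgeVar_mem_aliveVars]

/-- The part of `P|_V` that belongs to the block `i`. -/
noncomputable def blockPoly (V : Choices n r' k') (i : Fin r') :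
    MvPolynomial (YVar n r' ⊕ ZVar n r' k') F :=
  ∑ p, ∑ q, rename Sum.inr (halfPoly F V (i, false) p) * X (Sum.inl (i, p, q))
    * rename Sum.inr (halfPoly F V (i, true) q)

theorem blockMatrix_prod (V : Choices n r' k') (i : Fin r') (o : Fin n) (ho : (o : ℕ) = 0)
    (q : Fin n) :
    ((List.range (2 * k' + 3)).map (blockMatrix F V i)).prod o q
      = if q = o then blockPoly F V i else 0 := by
  rw [block_prod o (A := edgeWeight F V (i, false)) (B := edgeWeight F V (i, true))
    (Y := fun p q => X (Sum.inl (i, p, q)))]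
  · simp only [layerSum_edgeWeight, blockPoly]
  · intro q
    simp [blockMatrix, ho]
  · intro s hs p q
    have h1 : k' - (s + 1) = k' - 1 - s := by omega
    rw [← aeval_randRestrict_edgeVar F V (i, false) ⟨k' - 1 - s, by omega⟩ q p]
    rw [blockMatrix, if_neg (by omega), if_neg (by omega), if_neg (by omega),
      dif_pos (by omega)]
    simp only [edgeVar, h1]
    rfl
  · intro p q
    rw [blockMatrix, if_neg (by omega), if_neg (by omega), if_pos rfl]
    simp [randRestrict]
  · intro s hs p q
    rw [← aeval_randRestrict_edgeVar F V (i, true) ⟨s, hs⟩ p q]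
    rw [blockMatrix, if_neg (by omega), if_neg (by omega), if_neg (by omega),
      dif_neg (by omega), dif_pos (by omega)]
    simp only [edgeVar, show k' + 2 + s - (k' + 2) = s by omega]
    rfl
  · intro p q
    rw [blockMatrix, if_neg (by omega), if_pos rfl]
    have : (q : ℕ) = 0 ↔ q = o := by rw [← ho, Fin.val_inj]
    simp [this]

theorem restrictedIMM_eq_prod (hn : 0 < n) (V : Choices n r' k') :
    restrictedIMM F V = ∏ i, blockPoly F V i := by
  set o : Fin n := ⟨0, hn⟩ with ho
  have ho' : ∀ x : Fin n, (x : ℕ) = 0 ↔ x = o := fun x => by rw [ho, Fin.ext_iff]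
  have hent : ∀ t : Fin (r' * (2 * k' + 3)), ∀ p q,
      aeval (randRestrict F V) (detRestrict F (t, p, q))
      = blockMatrix F V (finProdFinEquiv.symm t).1 (finProdFinEquiv.symm t).2 p q :=
    fun t p q => rfl
  have hwalk : restrictedIMM F V = (List.ofFn fun t : Fin (r' * (2 * k' + 3)) =>
      blockMatrix F V (finProdFinEquiv.symm t).1 (finProdFinEquiv.symm t).2).prod o o := by
    rw [← sum_walks_eq_prod, restrictedIMM, IMM]
    simp only [map_sum, map_prod, aeval_X, hent, ho']
  rw [hwalk, ofFn_finProdFinEquiv fun (i : Fin r') (j : Fin (2 * k' + 3)) =>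
    blockMatrix F V i (j : ℕ), List.prod_flatten, List.map_ofFn]
  have hblock : ((List.prod : List (Matrix (Fin n) (Fin n) _) → _) ∘ fun i : Fin r' =>
      List.ofFn fun j : Fin (2 * k' + 3) => blockMatrix F V i (j : ℕ))
      = fun i => ((List.range (2 * k' + 3)).map (blockMatrix F V i)).prod := by
    funext i
    rw [Function.comp_apply, List.ofFn_eq_map, ← List.map_coe_finRange_eq_range, List.map_map]
    rfl
  rw [hblock, prod_apply_of_row]
  · rw [List.map_ofFn, List.prod_ofFn]
    refine Finset.prod_congr rfl fun i _ => ?_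
    rw [Function.comp_apply, blockMatrix_prod F V i o rfl, if_pos rfl]
  · intro B hB q hq
    obtain ⟨i, rfl⟩ := (List.mem_ofFn' _ _).1 hB
    exact (blockMatrix_prod F V i o rfl q).trans (if_neg hq)

end Restricted

/-! ### The monomials of the derivatives -/

section Derivative

variable {n r' k' : ℕ} (F : Type*) [Field F]

theorem pderiv_inl_rename_inr {Yv Zv : Type*} (y : Yv) (f : MvPolynomial Zv F) :
    pderiv (Sum.inl y) (rename Sum.inr f : MvPolynomial (Yv ⊕ Zv) F) = 0 := by
  classical
  refine pderiv_eq_zero_of_notMem_vars fun h => ?_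
  have := vars_rename (Sum.inr : Zv → Yv ⊕ Zv) f h
  simp at this

theorem pderiv_prod_eq_zero {σ ι : Type*} (y : σ) (s : Finset ι) (f : ι → MvPolynomial σ F)
    (h : ∀ i ∈ s, pderiv y (f i) = 0) : pderiv y (∏ i ∈ s, f i) = 0 := by
  refine Finset.prod_induction f (fun g => pderiv y g = 0) (fun a b ha hb => ?_) (by simp) h
  rw [Derivation.leibniz, ha, hb, smul_zero, smul_zero, add_zero]

theorem pderiv_blockPoly_self (V : Choices n r' k') (i : Fin r') (p q : Fin n) :
    pderiv (Sum.inl (i, p, q)) (blockPoly F V i)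
      = rename Sum.inr (halfPoly F V (i, false) p * halfPoly F V (i, true) q) := by
  classical
  rw [blockPoly, map_sum, Finset.sum_eq_single p, map_sum, Finset.sum_eq_single q]
  · simp [Derivation.leibniz, pderiv_inl_rename_inr, mul_comm]
  · intro q' _ hq
    simp [Derivation.leibniz, pderiv_inl_rename_inr, pderiv_X, hq.symm]
  · simp
  · intro p' _ hp
    rw [map_sum]
    refine Finset.sum_eq_zero fun q' _ => ?_
    simp [Derivation.leibniz, pderiv_inl_rename_inr, pderiv_X, hp.symm]
  · simp

theorem pderiv_blockPoly_of_ne (V : Choices n r' k') {i j : Fin r'} (h : i ≠ j) (p q : Fin n) :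
    pderiv (Sum.inl (i, p, q)) (blockPoly F V j) = 0 := by
  classical
  simp [blockPoly, Derivation.leibniz, pderiv_inl_rename_inr, pderiv_X, h.symm]

/-- The roots of the half-blocks given by the index vector of a `Y`-monomial. -/
def rootOf (v : Fin (2 * r') → Fin n) (h : Half r') : Fin n :=
  if h.2 = true then v ⟨2 * h.1 + 1, by omega⟩ else v ⟨2 * h.1, by omega⟩

theorem toMultiset_yMonomial (v : Fin (2 * r') → Fin n) :
    Finsupp.toMultiset (yMonomial k' v) = (Finset.univ : Finset (Fin r')).val.map fun i =>
      (Sum.inl (i, rootOf v (i, false), rootOf v (i, true)) : YVar n r' ⊕ ZVar n r' k') := by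
  rw [yMonomial, map_sum, ← Multiset.sum_map_singleton (Multiset.map _ _), Multiset.map_map]
  refine Finset.sum_congr rfl fun i _ => ?_
  simp [rootOf]

theorem degree_yMonomial (v : Fin (2 * r') → Fin n) : (yMonomial k' v).degree = r' := by
  simp [yMonomial]

/-- Differentiating with respect to one variable of each block leaves the polynomials of the
half-blocks at the row and the column of that variable. -/
theorem monomialDeriv_prod_blockPoly (V : Choices n r' k') (v : Fin (2 * r') → Fin n) :
    monomialDeriv (yMonomial k' v) (∏ i, blockPoly F V i)
      = rename Sum.inr (∏ h : Half r', halfPoly F V h (rootOf v h)) := by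
  classical
  have key : ∀ I : Finset (Fin r'), (I.val.map fun i =>
      (Sum.inl (i, rootOf v (i, false), rootOf v (i, true)) : YVar n r' ⊕ ZVar n r' k')).foldr
        (fun y g => pderiv y g) (∏ i, blockPoly F V i)
      = (∏ i ∈ I, rename Sum.inr (halfPoly F V (i, false) (rootOf v (i, false))
          * halfPoly F V (i, true) (rootOf v (i, true)))) * ∏ i ∈ Iᶜ, blockPoly F V i := by
    intro I
    induction I using Finset.induction_on with
    | empty => simp
    | insert j I hj ih =>
      rw [Finset.insert_val_of_notMem hj, Multiset.map_cons, Multiset.foldr_cons, ih,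
        Finset.prod_insert hj,
        show Iᶜ = insert j (insert j I)ᶜ by rw [Finset.insert_compl_insert hj],
        Finset.prod_insert (by simp), Derivation.leibniz, Derivation.leibniz,
        pderiv_prod_eq_zero F _ I _ fun i _ => pderiv_inl_rename_inr F _ _,
        pderiv_prod_eq_zero F _ (insert j I)ᶜ _ fun i hi =>
          pderiv_blockPoly_of_ne F V (fun h => by simp [← h] at hi) _ _,
        pderiv_blockPoly_self]
      simp only [smul_eq_mul]
      ring
  rw [monomialDeriv, toMultiset_yMonomial, key, Finset.compl_univ, Finset.prod_empty, mul_one,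
    Fintype.prod_prod_type, map_prod]
  refine Finset.prod_congr rfl fun i _ => ?_
  rw [Fintype.prod_bool, mul_comm]

theorem sigmaY_rename_inr {Yv Zv : Type*} (f : MvPolynomial Zv F) :
    sigmaY (rename Sum.inr f : MvPolynomial (Yv ⊕ Zv) F) = f := by
  rw [sigmaY, aeval_rename, Sum.elim_comp_inr, aeval_X_left_apply]

/-- The variables on the paths `W h` with roots `ρ h`, for all half-blocks `h`. -/
def edgeSet (ρ : Half r' → Fin n) (W : Half r' → Fin k' → Fin n) : Finset (ZVar n r' k') :=
  Finset.univ.image fun x : Half r' × Fin k' =>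
    edgeVar x.1 x.2 (prevVertex (ρ x.1) (W x.1) x.2) (W x.1 x.2)

/-- The families of alive paths, one in each half-block `h`, with roots `ρ h`. -/
def multiPaths (V : Choices n r' k') (ρ : Half r' → Fin n) :
    Finset (Half r' → Fin k' → Fin n) :=
  Fintype.piFinset fun h => paths (halfOf V h) (ρ h)

theorem edgeVar_path_injective (ρ : Half r' → Fin n) (W : Half r' → Fin k' → Fin n) :
    Function.Injective fun x : Half r' × Fin k' =>
      edgeVar x.1 x.2 (prevVertex (ρ x.1) (W x.1) x.2) (W x.1 x.2) := fun _ _ h =>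
  Prod.ext (edgeVar_inj.1 h).1 (edgeVar_inj.1 h).2.1

theorem mem_edgeSet {ρ ρ' : Half r' → Fin n} {W W' : Half r' → Fin k' → Fin n}
    {x : Half r' × Fin k'} :
    edgeVar x.1 x.2 (prevVertex (ρ x.1) (W x.1) x.2) (W x.1 x.2) ∈ edgeSet ρ' W'
      ↔ prevVertex (ρ' x.1) (W' x.1) x.2 = prevVertex (ρ x.1) (W x.1) x.2
        ∧ W' x.1 x.2 = W x.1 x.2 := by
  simp only [edgeSet, Finset.mem_image, Finset.mem_univ, true_and, edgeVar_inj]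
  constructor
  · rintro ⟨⟨h, j⟩, rfl, rfl, h1, h2⟩
    exact ⟨h1, h2⟩
  · rintro ⟨h1, h2⟩
    exact ⟨x, rfl, rfl, h1, h2⟩

theorem edgeSet_injective (ρ : Half r' → Fin n) :
    Function.Injective (edgeSet ρ : (Half r' → Fin k' → Fin n) → _) := by
  intro W W' h
  funext i j
  have : edgeVar i j (prevVertex (ρ i) (W i) j) (W i j) ∈ edgeSet ρ W' := by
    rw [← h]
    exact Finset.mem_image_of_mem _ (Finset.mem_univ (i, j))
  exact ((mem_edgeSet (x := (i, j))).1 this).2.symm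

theorem sqfree_edgeSet_injective (ρ : Half r' → Fin n) :
    Function.Injective fun W : Half r' → Fin k' → Fin n => sqfree (edgeSet ρ W) :=
  sqfree_injective.comp (edgeSet_injective ρ)

theorem card_edgeSet (ρ : Half r' → Fin n) (W : Half r' → Fin k' → Fin n) :
    (edgeSet ρ W).card = 2 * k' * r' := by
  rw [edgeSet, Finset.card_image_of_injective _ (edgeVar_path_injective ρ W)]
  simp
  ring

theorem edgeSet_subset {V : Choices n r' k'} {ρ : Half r' → Fin n}
    {W : Half r' → Fin k' → Fin n} (hW : W ∈ multiPaths V ρ) : edgeSet ρ W ⊆ aliveVars V := by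
  intro z hz
  simp only [edgeSet, Finset.mem_image, Finset.mem_univ, true_and] at hz
  obtain ⟨x, rfl⟩ := hz
  rw [edgeVar_mem_aliveVars]
  exact mem_paths.1 (Fintype.mem_piFinset.1 hW x.1) x.2

theorem pow_card_edgeSet_sdiff (x : ℝ) (ρ ρ' : Half r' → Fin n)
    (W W' : Half r' → Fin k' → Fin n) :
    x ^ (edgeSet ρ' W' \ edgeSet ρ W).card = ∏ h, ∏ j,
      if prevVertex (ρ h) (W h) j = prevVertex (ρ' h) (W' h) j ∧ W h j = W' h j then 1 else x := by
  rw [← Fintype.prod_prod_type'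
    (f := fun (h : Half r') (j : Fin k') => if prevVertex (ρ h) (W h) j =
      prevVertex (ρ' h) (W' h) j ∧ W h j = W' h j then (1 : ℝ) else x),
    Finset.prod_ite, Finset.prod_const_one, one_mul, Finset.prod_const]
  congr 1
  rw [← Finset.card_image_of_injective _ (edgeVar_path_injective ρ' W')]
  congr 1
  ext z
  simp only [Finset.mem_sdiff, Finset.mem_image, Finset.mem_filter, Finset.mem_univ, true_and]
  constructor
  · rintro ⟨h1, h2⟩
    obtain ⟨y, _, rfl⟩ := Finset.mem_image.1 h1
    exact ⟨y, fun h => h2 (mem_edgeSet.2 h), rfl⟩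
  · rintro ⟨y, h, rfl⟩
    exact ⟨Finset.mem_image_of_mem _ (Finset.mem_univ y), fun h' => h (mem_edgeSet.1 h')⟩

theorem prod_halfPoly (V : Choices n r' k') (ρ : Half r' → Fin n) :
    ∏ h : Half r', halfPoly F V h (ρ h)
      = ∑ W ∈ multiPaths V ρ, monomial (sqfree (edgeSet ρ W)) 1 := by
  classical
  unfold halfPoly
  rw [Finset.prod_univ_sum]
  refine Finset.sum_congr rfl fun W _ => ?_
  rw [← Fintype.prod_prod_type' (f := fun (h : Half r') (j : Fin k') =>
    (X (edgeVar h j (prevVertex (ρ h) (W h) j) (W h j)) : MvPolynomial (ZVar n r' k') F)),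
    sqfree, edgeSet, Finset.sum_image fun _ _ _ _ h => edgeVar_path_injective ρ W h,
    monomial_sum_one]
  rfl

open Classical in
/-- The monomials of `σ_Y(∂_α P|_V)` are the products of the variables along a family of paths. -/
theorem monoSet_restrictedIMM (hn : 0 < n) (V : Choices n r' k') (v : Fin (2 * r') → Fin n) :
    monoSet (restrictedIMM F V) (yMonomial k' v)
      = (multiPaths V (rootOf v)).image fun W => sqfree (edgeSet (rootOf v) W) := by
  rw [monoSet, restrictedIMM_eq_prod F hn, monomialDeriv_prod_blockPoly, sigmaY_rename_inr,
    prod_halfPoly]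
  have hinj := sqfree_edgeSet_injective (k' := k') (rootOf v)
  ext s
  rw [mem_support_iff, coeff_sum]
  simp only [coeff_monomial, Finset.mem_image]
  by_cases hs : ∃ W ∈ multiPaths V (rootOf v), sqfree (edgeSet (rootOf v) W) = s
  · obtain ⟨W, hW, rfl⟩ := hs
    rw [Finset.sum_eq_single W]
    · simpa using ⟨W, hW, rfl⟩
    · intro W' _ hne
      exact if_neg fun h => hne (hinj h)
    · exact fun h => absurd hW h
  · rw [Finset.sum_eq_zero fun W hW => if_neg fun h => hs ⟨W, hW, h⟩]
    simpa using hs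

theorem isHomogeneous_halfPoly (V : Choices n r' k') (h : Half r') (u : Fin n) :
    (halfPoly F V h u).IsHomogeneous k' := by
  refine IsHomogeneous.sum _ _ _ fun w _ => ?_
  simpa using IsHomogeneous.prod Finset.univ
    (fun j => (X (edgeVar h j (prevVertex u w j) (w j)) : MvPolynomial (ZVar n r' k') F))
    (fun _ => 1) fun j _ => isHomogeneous_X F _

theorem isHomogeneous_restrictedIMM (hn : 0 < n) (V : Choices n r' k') :
    (restrictedIMM F V).IsHomogeneous (r' * (2 * k' + 1)) := by
  rw [restrictedIMM_eq_prod F hn]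
  have := IsHomogeneous.prod Finset.univ (fun i => blockPoly F V i) (fun _ => 2 * k' + 1)
    fun i _ => ?_
  · simpa using this
  refine IsHomogeneous.sum _ _ _ fun p _ => IsHomogeneous.sum _ _ _ fun q _ => ?_
  rw [show 2 * k' + 1 = k' + 1 + k' by ring]
  exact (((isHomogeneous_halfPoly F V _ p).rename_isHomogeneous).mul (isHomogeneous_X F _)).mul
    ((isHomogeneous_halfPoly F V _ q).rename_isHomogeneous)

theorem monomialDeriv_zero {σ : Type*} (α : σ →₀ ℕ) :
    monomialDeriv α (0 : MvPolynomial σ F) = 0 := by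
  unfold monomialDeriv
  induction Finsupp.toMultiset α using Multiset.induction_on with
  | empty => simp
  | cons a s ih => rw [Multiset.foldr_cons, ih, map_zero]

theorem totalDegree_restrictedIMM (hn : 0 < n) (V : Choices n r' k')
    {α : (YVar n r' ⊕ ZVar n r' k') →₀ ℕ} (h : (monoSet (restrictedIMM F V) α).Nonempty) :
    (restrictedIMM F V).totalDegree = r' * (2 * k' + 1) := by
  refine (isHomogeneous_restrictedIMM F hn V).totalDegree fun h0 => ?_
  rw [h0, monoSet, monomialDeriv_zero, map_zero, support_zero] at h
  exact Finset.not_nonempty_empty h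

end Derivative

/-! ### Cardinalities, and the sums `T₁`, `T₂`, `T₃` for a fixed restriction -/

section Sums

variable {n r' k' : ℕ} (F : Type*) [Field F]

theorem card_aliveVars {V : Choices n r' k'} {g : Fin k' → ℕ}
    (hV : ∀ h j u, (halfOf V h j u).card = g j) :
    (aliveVars V).card = 2 * r' * n * ∑ j, g j := by
  classical
  have h1 : aliveVars V = (Finset.univ.sigma fun x : Half r' × Fin k' × Fin n =>
      halfOf V x.1 x.2.1 x.2.2).image fun y => edgeVar y.1.1 y.1.2.1 y.1.2.2 y.2 := by
    ext z
    simp only [Finset.mem_image, Finset.mem_sigma, Finset.mem_univ, true_and]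
    constructor
    · intro hz
      obtain ⟨⟨i, b⟩, j, p, q⟩ := z
      cases b
      · exact ⟨⟨((i, false), j, q), p⟩, by simpa [aliveVars, halfOf] using hz, by simp [edgeVar]⟩
      · exact ⟨⟨((i, true), j, p), q⟩, by simpa [aliveVars, halfOf] using hz, by simp [edgeVar]⟩
    · rintro ⟨y, hy, rfl⟩
      exact edgeVar_mem_aliveVars.2 hy
  rw [h1, Finset.card_image_of_injective, Finset.card_sigma]
  · simp_rw [hV]
    simp only [Fintype.sum_prod_type, Finset.sum_const, Finset.card_univ, Fintype.card_fin,
      Fintype.card_prod, Fintype.card_bool, smul_eq_mul, ← Finset.mul_sum]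
    ring
  · rintro ⟨⟨h, j, u⟩, e⟩ ⟨⟨h', j', u'⟩, e'⟩ H
    obtain ⟨rfl, rfl, rfl, rfl⟩ := edgeVar_inj.1 H
    rfl

theorem card_multiPaths {V : Choices n r' k'} {g : Fin k' → ℕ}
    (hV : ∀ h j u, (halfOf V h j u).card = g j) (ρ : Half r' → Fin n) :
    (multiPaths V ρ).card = (∏ j, g j) ^ (2 * r') := by
  rw [multiPaths, Fintype.card_piFinset,
    Finset.prod_congr rfl fun h _ => card_paths (hV h) (ρ h)]
  simp [mul_comm]

theorem card_monoSet (hn : 0 < n) (V : Choices n r' k') (v : Fin (2 * r') → Fin n) :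
    (monoSet (restrictedIMM F V) (yMonomial k' v)).card = (multiPaths V (rootOf v)).card := by
  classical
  rw [monoSet_restrictedIMM F hn, Finset.card_image_of_injective _
    (sqfree_edgeSet_injective _)]

theorem T1_restrictedIMM (hn : 0 < n) (V : Choices n r' k') (v : Fin (2 * r') → Fin n) (m : ℕ) :
    T1 (aliveVars V) m (restrictedIMM F V) (yMonomial k' v)
      = (multiPaths V (rootOf v)).card * ((aliveVars V).card - 2 * k' * r').choose m := by
  classical
  rw [T1, ← card_monoSet F hn, ← smul_eq_mul, ← Finset.sum_const]
  refine Finset.sum_congr rfl fun β hβ => ?_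
  rw [monoSet_restrictedIMM F hn, Finset.mem_image] at hβ
  obtain ⟨W, hW, rfl⟩ := hβ
  rw [ncard_setS_sqfree (edgeSet_subset hW), card_edgeSet]

theorem sum_monoSet_product_le (hn : 0 < n) {V : Choices n r' k'} (v v' : Fin (2 * r') → Fin n)
    (f : (ZVar n r' k' →₀ ℕ) × (ZVar n r' k' →₀ ℕ) → ℕ) {P : _ → Prop} (hP : DecidablePred P)
    {D x : ℝ} (hf : ∀ W ∈ multiPaths V (rootOf v), ∀ W' ∈ multiPaths V (rootOf v'),
      (f (sqfree (edgeSet (rootOf v) W), sqfree (edgeSet (rootOf v') W')) : ℝ)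
        ≤ D * x ^ (edgeSet (rootOf v') W' \ edgeSet (rootOf v) W).card) :
    ((∑ p ∈ monoSet (restrictedIMM F V) (yMonomial k' v) ×ˢ
        monoSet (restrictedIMM F V) (yMonomial k' v') with P p, f p : ℕ) : ℝ)
      ≤ D * ∏ h, pairSum x (halfOf V h) (rootOf v h) (rootOf v' h) := by
  classical
  refine (Nat.cast_le.2 (Finset.sum_le_sum_of_subset (Finset.filter_subset _ _))).trans ?_
  rw [monoSet_restrictedIMM F hn, monoSet_restrictedIMM F hn, Finset.sum_product,
    Finset.sum_image fun W _ W' _ h => sqfree_edgeSet_injective _ h]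
  simp_rw [Finset.sum_image fun W _ W' _ h => sqfree_edgeSet_injective _ h]
  push_cast
  refine (Finset.sum_le_sum fun W hW => Finset.sum_le_sum fun W' hW' => hf W hW W' hW').trans
    (le_of_eq ?_)
  simp_rw [← Finset.mul_sum, pow_card_edgeSet_sdiff]
  congr 1
  unfold pairSum
  rw [Finset.prod_univ_sum]
  refine Finset.sum_congr rfl fun W _ => ?_
  rw [Finset.prod_univ_sum]
  rfl

theorem card_edgeSet_add_le {V : Choices n r' k'} {ρ ρ' : Half r' → Fin n}
    {W W' : Half r' → Fin k' → Fin n} (hW : W ∈ multiPaths V ρ) (hW' : W' ∈ multiPaths V ρ') :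
    2 * k' * r' + (edgeSet ρ' W' \ edgeSet ρ W).card ≤ (aliveVars V).card := by
  rw [← card_edgeSet ρ W, ← Finset.card_union_of_disjoint Finset.disjoint_sdiff,
    Finset.union_sdiff_self_eq_union]
  exact Finset.card_le_card (Finset.union_subset (edgeSet_subset hW) (edgeSet_subset hW'))

theorem T2_restrictedIMM_le (hn : 0 < n) {V : Choices n r' k'} (v : Fin (2 * r') → Fin n) {m : ℕ}
    (hm : m ≤ (aliveVars V).card) (hN : 0 < (aliveVars V).card) :
    (T2 (aliveVars V) m (restrictedIMM F V) (yMonomial k' v) : ℝ)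
      ≤ (((aliveVars V).card - 2 * k' * r').choose m : ℕ) * ∏ h,
        pairSum ((((aliveVars V).card : ℝ) - m) / (aliveVars V).card) (halfOf V h)
          (rootOf v h) (rootOf v h) := by
  refine sum_monoSet_product_le F hn v v _ _ fun W hW W' hW' => ?_
  rw [ncard_setS_inter (edgeSet_subset hW) (edgeSet_subset hW'), card_edgeSet]
  convert choose_sub_le (aliveVars V).card (2 * k' * r') m _ (card_edgeSet_add_le hW hW') hm hN

theorem T3_restrictedIMM_le (hn : 0 < n) (mo : MonomialOrder (ZVar n r' k'))
    {V : Choices n r' k'} (v v' : Fin (2 * r') → Fin n) {m : ℕ}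
    (hm : m + 2 * k' * r' ≤ (aliveVars V).card) :
    (T3 mo (aliveVars V) m (restrictedIMM F V) (yMonomial k' v) (yMonomial k' v') : ℝ)
      ≤ (((aliveVars V).card - 2 * k' * r').choose m : ℕ) * ∏ h,
        pairSum ((m : ℝ) / ((aliveVars V).card - (2 * k' * r' : ℕ))) (halfOf V h)
          (rootOf v h) (rootOf v' h) := by
  classical
  refine sum_monoSet_product_le F hn v v' _ _ fun W hW W' hW' => ?_
  have hpos : (0 : ℝ) ≤ (aliveVars V).card - (2 * k' * r' : ℕ) :=
    sub_nonneg.2 (by exact_mod_cast (by omega : 2 * k' * r' ≤ (aliveVars V).card))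
  have hdeg : (restrictedIMM F V).totalDegree = r' * (2 * k' + 1) :=
    totalDegree_restrictedIMM F hn V (α := yMonomial k' v) <| by
      rw [monoSet_restrictedIMM F hn]
      exact ⟨_, Finset.mem_image_of_mem _ hW⟩
  have hsupp : ∀ {B : Finset (ZVar n r' k')} {γ' γ : ZVar n r' k' →₀ ℕ}, γ' = γ + sqfree B →
      B ⊆ γ'.support := by
    rintro B γ' γ rfl z hz
    rw [Finsupp.mem_support_iff, Finsupp.add_apply, sqfree_apply, if_pos hz]
    omega
  have hle := ncard_inter_le_of_divisible (edgeSet_subset hW) (edgeSet_subset hW')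
    (m := m) (A := setA mo (aliveVars V) m (restrictedIMM F V) (yMonomial k' v)
        (sqfree (edgeSet (rootOf v) W)) ∩ setA mo (aliveVars V) m (restrictedIMM F V)
        (yMonomial k' v') (sqfree (edgeSet (rootOf v') W'))) (by
      rintro γ ⟨⟨h1, h2, h3, _, _, _, _, h4⟩, ⟨_, _, _, _, _, _, _, h5⟩⟩
      refine ⟨h1, h2, ?_, hsupp h4, hsupp h5⟩
      rw [h3, hdeg, degree_yMonomial, card_edgeSet, Nat.mul_add, mul_one, Nat.add_sub_cancel]
      ring)
  refine (Nat.cast_le.2 hle).trans ?_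
  rw [card_edgeSet]
  split_ifs with ht
  · convert choose_sub_sub_le (aliveVars V).card (2 * k' * r') m _ (card_edgeSet_add_le hW hW')
      hm ht
  · rw [Nat.cast_zero]
    exact mul_nonneg (Nat.cast_nonneg _) (pow_nonneg (div_nonneg (Nat.cast_nonneg _) hpos) _)

end Sums

/-! ### Expectations over the random restriction -/

section Expectation

variable {n r' k' a l : ℕ}

theorem mem_restrictions {V : Choices n r' k'} :
    V ∈ restrictions n r' k' a l ↔ ∀ h j u, (halfOf V h j u).card = numAlive k' a l j := by
  simp only [restrictions, Fintype.mem_piFinset, Finset.mem_powersetCard, Finset.subset_univ,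
    true_and, halfOf]
  exact ⟨fun H h j u => H (h, j, u), fun H x => H x.1 x.2.1 x.2.2⟩

/-- The half-blocks are independent. -/
theorem sum_restrictions_prod (f : Half r' → (Fin k' → Fin n → Finset (Fin n)) → ℝ) :
    ∑ V ∈ restrictions n r' k' a l, ∏ h, f h (halfOf V h)
      = ∏ h, ∑ c ∈ halfChoices n (numAlive k' a l), f h c := by
  rw [Finset.prod_univ_sum]
  refine Finset.sum_bij' (fun V _ h => halfOf V h) (fun W _ x => W x.1 x.2.1 x.2.2)
    (fun V hV => ?_) (fun W hW => ?_) (fun V _ => rfl) (fun W _ => rfl) (fun V _ => rfl)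
  · rw [Fintype.mem_piFinset]
    exact fun h => mem_halfChoices.2 (mem_restrictions.1 hV h)
  · rw [Fintype.mem_piFinset] at hW
    exact mem_restrictions.2 fun h => mem_halfChoices.1 (hW h)

theorem card_restrictions :
    ((restrictions n r' k' a l).card : ℝ)
      = ∏ _h : Half r', ((halfChoices n (numAlive k' a l)).card : ℝ) := by
  have := sum_restrictions_prod (n := n) (r' := r') (k' := k') (a := a) (l := l) fun _ _ => 1
  simpa using this

/-- The number of out-neighbours of a vertex after whose step `s` layers remain. -/
def aliveRev (k' a l s : ℕ) : ℕ := if s + 1 = k' then a else if l ≤ s then 2 else 1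

theorem numAlive_eq_aliveRev (j : Fin k') : numAlive k' a l j = aliveRev k' a l j.rev := by
  have := j.isLt
  simp only [numAlive, aliveRev, Fin.val_rev]
  split_ifs <;> first | rfl | omega

theorem one_le_aliveRev (ha : 1 ≤ a) (s : ℕ) : 1 ≤ aliveRev k' a l s := by
  unfold aliveRev
  split_ifs <;> omega

theorem numAlive_layers (t a l : ℕ) :
    numAlive (t + l + 1) a l 0 = a ∧
    (∀ i : Fin t, numAlive (t + l + 1) a l (Fin.castAdd l i).succ = 2) ∧
    ∀ i : Fin l, numAlive (t + l + 1) a l (Fin.natAdd t i).succ = 1 := by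
  refine ⟨rfl, fun i => ?_, fun i => ?_⟩ <;> have := i.isLt <;>
    simp only [numAlive, Fin.val_succ, Fin.val_castAdd, Fin.val_natAdd]
  · rw [if_neg (by omega), if_pos (by omega)]
  · rw [if_neg (by omega), if_neg (by omega)]

theorem sum_numAlive (hl : l + 1 ≤ k') :
    ∑ j, numAlive k' a l j = a + 2 * (k' - l - 1) + l := by
  obtain ⟨t, rfl⟩ : ∃ t, k' = (t + l) + 1 := ⟨k' - l - 1, by omega⟩
  obtain ⟨h0, h1, h2⟩ := numAlive_layers t a l
  rw [Fin.sum_univ_succ, Fin.sum_univ_add, h0, Finset.sum_congr rfl fun i _ => h1 i,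
    Finset.sum_congr rfl fun i _ => h2 i, show t + l + 1 - l - 1 = t by omega]
  simp
  ring

theorem prod_numAlive (hl : l + 1 ≤ k') :
    ∏ j, numAlive k' a l j = a * 2 ^ (k' - l - 1) := by
  obtain ⟨t, rfl⟩ : ∃ t, k' = (t + l) + 1 := ⟨k' - l - 1, by omega⟩
  obtain ⟨h0, h1, h2⟩ := numAlive_layers t a l
  rw [Fin.prod_univ_succ, Fin.prod_univ_add, h0, Finset.prod_congr rfl fun i _ => h1 i,
    Finset.prod_congr rfl fun i _ => h2 i, show t + l + 1 - l - 1 = t by omega]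
  simp

theorem expect_prod_pairSum_le {x : ℝ} (hx : 0 ≤ x) (ha : 1 ≤ a) (ρ ρ' : Half r' → Fin n) :
    (Finset.expect (restrictions n r' k' a l) fun V =>
        ∏ h, pairSum x (halfOf V h) (ρ h) (ρ' h))
      ≤ ((∏ j, numAlive k' a l j : ℕ) : ℝ) ^ (2 * r') *
        ∏ h, if ρ h = ρ' h then (pairBound x n (aliveRev k' a l) k').1
          else (pairBound x n (aliveRev k' a l) k').2 := by
  have hG := one_le_aliveRev (k' := k') (l := l) ha
  obtain ⟨hα, hβ⟩ := pairBound_nonneg hx n hG k'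
  have hps : ∀ (c : Fin k' → Fin n → Finset (Fin n)) (u u' : Fin n), 0 ≤ pairSum x c u u' :=
    fun c u u' => Finset.sum_nonneg fun w _ => Finset.sum_nonneg fun w' _ =>
      Finset.prod_nonneg fun j _ => by split_ifs <;> [exact zero_le_one; exact hx]
  have hif : ∀ h, 0 ≤ if ρ h = ρ' h then (pairBound x n (aliveRev k' a l) k').1
          else (pairBound x n (aliveRev k' a l) k').2 := fun h => by
    split_ifs <;> assumption
  rw [Finset.expect_eq_sum_div_card,
    sum_restrictions_prod fun h c => pairSum x c (ρ h) (ρ' h)]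
  refine div_le_of_le_mul₀ (Nat.cast_nonneg _)
    (mul_nonneg (by positivity) (Finset.prod_nonneg fun h _ => hif h)) ?_
  have hcard : ((∏ j, numAlive k' a l j : ℕ) : ℝ) ^ (2 * r')
      = ∏ _h : Half r', ((∏ j, numAlive k' a l j : ℕ) : ℝ) := by
    simp [mul_comm]
  rw [hcard, card_restrictions, ← Finset.prod_mul_distrib, ← Finset.prod_mul_distrib]
  refine Finset.prod_le_prod (fun h _ => Finset.sum_nonneg fun c _ => hps _ _ _) fun h _ => ?_
  have := sum_pairSum_le (n := n) hx hG k' (ρ h) (ρ' h)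
  simp only [← numAlive_eq_aliveRev] at this
  rw [mul_comm, Nat.cast_prod]
  exact this

theorem expect_T2_le (F : Type*) [Field F] (hn : 0 < n) (ha : 1 ≤ a)
    (v : Fin (2 * r') → Fin n) {m k N : ℕ} (hk : k = 2 * k' * r') (hm : m ≤ N) (hN : 0 < N)
    (hV : ∀ V ∈ restrictions n r' k' a l, (aliveVars V).card = N) :
    (Finset.expect (restrictions n r' k' a l) fun V =>
        (T2 (aliveVars V) m (restrictedIMM F V) (yMonomial k' v) : ℝ))
      ≤ ((N - k).choose m : ℕ) * (((∏ j, numAlive k' a l j : ℕ) : ℝ) ^ (2 * r') *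
        ∏ _h : Half r', (pairBound (((N : ℝ) - m) / N) n (aliveRev k' a l) k').1) := by
  have hx : 0 ≤ ((N : ℝ) - m) / N :=
    div_nonneg (sub_nonneg.2 (by exact_mod_cast hm)) (Nat.cast_nonneg _)
  refine (Finset.expect_le_expect (g := fun V => (((N - k).choose m : ℕ) : ℝ) * ∏ h,
    pairSum (((N : ℝ) - m) / N) (halfOf V h) (rootOf v h) (rootOf v h)) fun V hVr => ?_).trans ?_
  · have hVN := hV V hVr
    subst hVN hk
    exact T2_restrictedIMM_le F hn v hm hN
  · rw [← Finset.mul_expect]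
    have := expect_prod_pairSum_le (k' := k') (l := l) hx ha (rootOf v) (rootOf v)
    simp only [if_true] at this
    gcongr

theorem expect_T3_le (F : Type*) [Field F] (hn : 0 < n) (ha : 1 ≤ a)
    (mo : MonomialOrder (ZVar n r' k')) (v v' : Fin (2 * r') → Fin n) {m k N : ℕ}
    (hk : k = 2 * k' * r') (hm : m + k ≤ N)
    (hV : ∀ V ∈ restrictions n r' k' a l, (aliveVars V).card = N) :
    (Finset.expect (restrictions n r' k' a l) fun V =>
        (T3 mo (aliveVars V) m (restrictedIMM F V) (yMonomial k' v) (yMonomial k' v') : ℝ))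
      ≤ ((N - k).choose m : ℕ) * (((∏ j, numAlive k' a l j : ℕ) : ℝ) ^ (2 * r') *
        ∏ h, if rootOf v h = rootOf v' h
          then (pairBound ((m : ℝ) / ((N : ℝ) - k)) n (aliveRev k' a l) k').1
          else (pairBound ((m : ℝ) / ((N : ℝ) - k)) n (aliveRev k' a l) k').2) := by
  have hx : 0 ≤ (m : ℝ) / ((N : ℝ) - k) :=
    div_nonneg (Nat.cast_nonneg _) (sub_nonneg.2 (by exact_mod_cast (by omega : k ≤ N)))
  refine (Finset.expect_le_expect (g := fun V => (((N - k).choose m : ℕ) : ℝ) * ∏ h,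
    pairSum ((m : ℝ) / ((N : ℝ) - k)) (halfOf V h) (rootOf v h) (rootOf v' h))
    fun V hVr => ?_).trans ?_
  · have hVN := hV V hVr
    subst hVN hk
    exact T3_restrictedIMM_le F hn mo v v' hm
  · rw [← Finset.mul_expect]
    have := expect_prod_pairSum_le (k' := k') (l := l) hx ha (rootOf v) (rootOf v')
    gcongr

end Expectation

/-! ### Estimates for the recursion -/

section Recursion

variable {n k' a l : ℕ} {x y : ℝ}

/-- Solution of the recursion below the first layer. The term `x ^ s * 2 ^ (s - l)` counts pairs of
paths that never meet, the other one those that do. -/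
theorem pairBound_le (hx0 : 0 ≤ x) (hx1 : x ≤ 1) (hxy : 2 * x ≤ y) (hy : 1 ≤ y)
    (hT : k' * (y ^ k' * ((1 / 2) ^ l + 2 * k' / n)) ≤ 1) {s : ℕ} (hs : s + 1 ≤ k') :
    (pairBound x n (aliveRev k' a l) s).1 ≤ 1 + s * (y ^ k' * ((1 / 2) ^ l + 2 * k' / n)) ∧
    (pairBound x n (aliveRev k' a l) s).2 ≤ x ^ s * 2 ^ (s - l) + y ^ s * (2 * s / n) ∧
    (l ≤ s → (pairBound x n (aliveRev k' a l) s).2 ≤ y ^ k' * ((1 / 2) ^ l + 2 * k' / n)) := by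
  set T := y ^ k' * ((1 / 2 : ℝ) ^ l + 2 * k' / n) with hTdef
  have hT0 : 0 ≤ T := by positivity
  have hlast : ∀ s ≤ k', l ≤ s → x ^ s * 2 ^ (s - l) + y ^ s * (2 * s / n) ≤ T := by
    intro s hsk hls
    have h1 : x ^ s * 2 ^ (s - l) = (2 * x) ^ s * (1 / 2) ^ l := by
      obtain ⟨t, rfl⟩ := Nat.exists_eq_add_of_le hls
      rw [Nat.add_sub_cancel_left, mul_pow, pow_add 2 l t, one_div, inv_pow]
      field_simp
    rw [h1, hTdef, mul_add]
    gcongr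
    calc (2 * x) ^ s ≤ y ^ s := by gcongr
      _ ≤ y ^ k' := by gcongr
  suffices H : (pairBound x n (aliveRev k' a l) s).1 ≤ 1 + s * T ∧
      (pairBound x n (aliveRev k' a l) s).2 ≤ x ^ s * 2 ^ (s - l) + y ^ s * (2 * s / n) from
    ⟨H.1, H.2, fun hls => H.2.trans (hlast s (by omega) hls)⟩
  induction s with
  | zero => simp [pairBound]
  | succ s ih =>
    obtain ⟨h1, h2⟩ := ih (by omega)
    have hα2 : (pairBound x n (aliveRev k' a l) s).1 ≤ 2 := by
      have : (s : ℝ) * T ≤ k' * T := by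
        gcongr
        omega
      linarith
    have hys : 1 ≤ y ^ s := one_le_pow₀ hy
    have hgen : x * (2 / n + y ^ s * (2 * s / n)) * 2 ≤ y ^ (s + 1) * (2 * (s + 1 : ℕ) / n) := by
      calc x * (2 / n + y ^ s * (2 * s / n)) * 2
          = 2 * x * (1 * (2 / n) + y ^ s * (2 * s / n)) := by ring
        _ ≤ y * (y ^ s * (2 / n) + y ^ s * (2 * s / n)) := by gcongr
        _ = _ := by push_cast; ring
    have hpos : 0 ≤ x * (2 / n + y ^ s * (2 * s / n)) := by positivity
    by_cases hls : l ≤ s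
    · have hG : aliveRev k' a l s = 2 := by
        rw [aliveRev, if_neg (by omega), if_pos hls]
      simp only [pairBound, hG]
      constructor
      · have h3 := h2.trans (hlast s (by omega) hls)
        have h4 : x * (pairBound x n (aliveRev k' a l) s).2 ≤ T := by
          calc _ ≤ x * T := by gcongr
            _ ≤ 1 * T := by gcongr
            _ = T := one_mul T
        push_cast
        linarith
      · calc _ ≤ x * (2 : ℕ) * (2 / n + (x ^ s * 2 ^ (s - l) + y ^ s * (2 * s / n))) := by gcongr
          _ = x ^ (s + 1) * 2 ^ (s - l + 1) + x * (2 / n + y ^ s * (2 * s / n)) * 2 := by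
            push_cast
            ring
          _ ≤ _ := by
            rw [show s + 1 - l = s - l + 1 by omega]
            gcongr
    · have hG : aliveRev k' a l s = 1 := by
        rw [aliveRev, if_neg (by omega), if_neg hls]
      simp only [pairBound, hG]
      constructor
      · push_cast
        linarith
      · calc _ ≤ x * (1 : ℕ) * (2 / n + (x ^ s * 2 ^ (s - l) + y ^ s * (2 * s / n))) := by gcongr
          _ = x ^ (s + 1) * 2 ^ (s - l) + x * (2 / n + y ^ s * (2 * s / n)) := by
            push_cast
            ring
          _ ≤ _ := by
            rw [show s + 1 - l = 0 by omega, show s - l = 0 by omega]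
            exact add_le_add le_rfl (by linarith)

theorem pairBound_top_le (hx0 : 0 ≤ x) (hx1 : x ≤ 1) (hxy : 2 * x ≤ y) (hy : 1 ≤ y) (ha : 1 ≤ a)
    (hl : l + 1 ≤ k') (hT : k' * (y ^ k' * ((1 / 2) ^ l + 2 * k' / n)) ≤ 1) :
    (pairBound x n (aliveRev k' a l) k').1
      ≤ 2 + a * (y ^ k' * ((1 / 2) ^ l + 2 * k' / n)) ∧
    (pairBound x n (aliveRev k' a l) k').2
      ≤ a * x ^ k' * 2 ^ (k' - l - 1) + a * y ^ k' * (2 * k' / n) := by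
  obtain ⟨s, rfl⟩ : ∃ s, k' = s + 1 := ⟨k' - 1, by omega⟩
  obtain ⟨h1, h2, h3⟩ := pairBound_le (a := a) hx0 hx1 hxy hy hT (s := s) le_rfl
  specialize h3 (by omega)
  have hG : aliveRev (s + 1) a l s = a := if_pos rfl
  have hβ0 := (pairBound_nonneg hx0 n (one_le_aliveRev (k' := s + 1) (l := l) ha) s).2
  set T := y ^ (s + 1) * ((1 / 2 : ℝ) ^ l + 2 * (s + 1 : ℕ) / n) with hTdef
  have hT0 : 0 ≤ T := by positivity
  have hα2 : (pairBound x n (aliveRev (s + 1) a l) s).1 ≤ 2 := by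
    have : (s : ℝ) * T ≤ (s + 1 : ℕ) * T := by
      gcongr
      omega
    linarith
  have ha1 : (1 : ℝ) ≤ a := by exact_mod_cast ha
  simp only [pairBound, hG]
  constructor
  · have h4 : ((a : ℝ) - 1) * x * (pairBound x n (aliveRev (s + 1) a l) s).2 ≤ a * T := by
      calc _ ≤ (a : ℝ) * 1 * (pairBound x n (aliveRev (s + 1) a l) s).2 := by
            gcongr
            linarith
        _ ≤ a * 1 * T := by gcongr
        _ = a * T := by ring
    linarith
  · have hys : 1 ≤ y ^ s := one_le_pow₀ hy
    calc _ ≤ x * a * (2 / n + (x ^ s * 2 ^ (s - l) + y ^ s * (2 * s / n))) := by gcongr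
      _ = a * x ^ (s + 1) * 2 ^ (s - l) + a * (x * (1 * (2 / n) + y ^ s * (2 * s / n))) := by ring
      _ ≤ a * x ^ (s + 1) * 2 ^ (s - l) + a * (y * (y ^ s * (2 / n) + y ^ s * (2 * s / n))) := by
        gcongr
        linarith
      _ = _ := by
        rw [show s + 1 - l - 1 = s - l by omega]
        push_cast
        ring

end Recursion

/-! ### Numerical consequences of the choice of parameters -/

section Numerics

/-- All powers of `n` that occur are estimated by integral powers of `w = n ^ 0.01`. -/
theorem exists_scale {n r' k' d a l : ℕ} (hr' : 1 ≤ r') (hd : d = (2 * k' + 3) * r')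
    (hdn : (d : ℝ) ≤ (n : ℝ) ^ (0.01 : ℝ)) (hk' : 0.340 * Real.logb 2 n + 1 ≤ k')
    (ha : |(a : ℝ) - (n : ℝ) ^ (0.05 : ℝ)| < 1)
    (hl : |(l : ℝ) - 0.340 * Real.logb 2 n| < 1) :
    ∃ w : ℝ, 5 ≤ w ∧ (n : ℝ) = w ^ 100 ∧ (d : ℝ) ≤ w ∧ (a : ℝ) ≤ 2 * w ^ 5 ∧ 1 ≤ a ∧
      1 ≤ k' ∧ l + 1 ≤ k' ∧ (1 / 2 : ℝ) ^ l ≤ 2 / w ^ 34 ∧ (n : ℝ) ^ (0.29 : ℝ) = w ^ 29 ∧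
      (n : ℝ) ^ ((1 - 0.08 : ℝ) * 0.631) ≤ w ^ 59 := by
  have hn0 : (0 : ℝ) ≤ n := n.cast_nonneg
  rw [abs_lt] at ha hl
  have hk1 : 1 ≤ k' := by
    have h0 : 0 ≤ Real.logb 2 n := by
      rcases Nat.eq_zero_or_pos n with rfl | hn
      · simp
      · exact Real.logb_nonneg (by norm_num) (by exact_mod_cast hn)
    have : (1 : ℝ) ≤ k' := by linarith
    exact_mod_cast this
  have hw5 : 5 ≤ (n : ℝ) ^ (0.01 : ℝ) := by
    refine le_trans ?_ hdn
    have : 5 * 1 ≤ d := by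
      rw [hd]
      exact Nat.mul_le_mul (by omega) hr'
    exact_mod_cast this
  set w := (n : ℝ) ^ (0.01 : ℝ) with hw
  have hpow : ∀ j : ℕ, (n : ℝ) ^ ((0.01 : ℝ) * j) = w ^ j := fun j => by
    rw [Real.rpow_mul hn0, Real.rpow_natCast]
  have h100 : (n : ℝ) = w ^ 100 := by
    rw [← hpow 100]
    norm_num
  have hn1 : (1 : ℝ) ≤ n := by
    rw [h100]
    exact one_le_pow₀ (by linarith)
  have h5 : (n : ℝ) ^ (0.05 : ℝ) = w ^ 5 := by
    rw [← hpow 5]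
    norm_num
  have h29 : (n : ℝ) ^ (0.29 : ℝ) = w ^ 29 := by
    rw [← hpow 29]
    norm_num
  have h34 : (n : ℝ) ^ (0.34 : ℝ) = w ^ 34 := by
    rw [← hpow 34]
    norm_num
  have hw5' : (1 : ℝ) < w ^ 5 := one_lt_pow₀ (by linarith) (by norm_num)
  rw [h5] at ha
  refine ⟨w, hw5, h100, hdn, by linarith, ?_, hk1, ?_, ?_, h29, ?_⟩
  · have : (0 : ℝ) < a := by linarith
    exact_mod_cast this
  · have : (l : ℝ) < k' := by linarith
    exact_mod_cast this
  · have h2 : w ^ 34 / 2 ≤ (2 : ℝ) ^ l := by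
      have : (2 : ℝ) ^ (Real.logb 2 n * 0.34 - 1) ≤ 2 ^ (l : ℝ) := by
        apply Real.rpow_le_rpow_of_exponent_le (by norm_num)
        linarith
      rwa [Real.rpow_sub (by norm_num), Real.rpow_mul (by norm_num),
        Real.rpow_logb (by norm_num) (by norm_num) (by linarith), h34, Real.rpow_one,
        Real.rpow_natCast] at this
    rw [one_div, inv_pow, inv_le_comm₀ (by positivity) (by positivity), inv_div]
    exact h2
  · rw [← hpow 59]
    apply Real.rpow_le_rpow_of_exponent_le hn1
    norm_num

/-- The quotients that govern the binomial coefficients, compared with `(1 + Γ) / 2`. -/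
theorem ratio_bounds {w N k m Γ : ℝ} {k' : ℕ} (hw : 5 ≤ w) (hN : w ^ 100 ≤ N) (hk2 : 2 ≤ k)
    (hkw : k ≤ w) (hk'w : (k' : ℝ) ≤ w) (hm0 : 0 ≤ m) (hΓ : 0 ≤ Γ)
    (hΓk : (1 + Γ) ^ k' = 2 * w ^ 29) (hm : |m - N / 2 * (1 - Γ)| < 1) :
    ∃ y : ℝ, 1 ≤ y ∧ y ^ k' ≤ 4 * w ^ 29 ∧ 0 < N ∧ m + k ≤ N ∧ 2 * ((N - m) / N) ≤ y ∧
      2 * (m / (N - k)) ≤ y ∧ (m / (N - m)) ^ k' ≤ 2 ∧ 0 ≤ m / (N - m) ∧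
      (m / (N - k)) ^ k' * 2 ^ k' ≤ (m / (N - m)) ^ k' * (4 * w ^ 29) := by
  rw [abs_lt] at hm
  have hw3 : 25 * w ≤ N := by
    have : w * 5 ^ 2 ≤ w * w ^ 99 := by
      gcongr
      calc (5 : ℝ) ^ 2 ≤ w ^ 2 := by gcongr
        _ ≤ w ^ 99 := by
          gcongr
          · linarith
          · norm_num
    nlinarith [this, hN, show w * w ^ 99 = w ^ 100 by ring]
  have hw4 : 25 * w ^ 2 ≤ N := by
    have : w ^ 2 * 5 ^ 2 ≤ w ^ 2 * w ^ 98 := by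
      gcongr
      calc (5 : ℝ) ^ 2 ≤ w ^ 2 := by gcongr
        _ ≤ w ^ 98 := by
          gcongr
          · linarith
          · norm_num
    nlinarith [this, hN, show w ^ 2 * w ^ 98 = w ^ 100 by ring]
  have hNΓ : 0 ≤ N * Γ := by
    apply mul_nonneg _ hΓ
    linarith
  have hNk : 0 < N - k := by linarith
  have hNm : 0 < N - m := by linarith
  have hN0 : 0 < N := by linarith
  set δ := (N + 2) / (N - k) with hδ
  have hδ1 : 1 ≤ δ := by
    rw [hδ, one_le_div hNk]
    linarith
  -- Bernoulli's inequality, as `k k'` is small compared with `N`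
  have hδk : δ ^ k' ≤ 2 := by
    have hinv : 1 + (k' : ℝ) * (-((k + 2) / (N + 2))) ≤ (1 + -((k + 2) / (N + 2))) ^ k' := by
      apply one_add_mul_le_pow
      have : (k + 2) / (N + 2) ≤ 1 := by
        rw [div_le_one (by linarith)]
        linarith
      linarith
    have heq : 1 + -((k + 2) / (N + 2)) = δ⁻¹ := by
      rw [hδ, inv_div]
      field_simp
      ring
    have hhalf : (1 / 2 : ℝ) ≤ 1 + (k' : ℝ) * (-((k + 2) / (N + 2))) := by
      have h1 : (k' : ℝ) * ((k + 2) / (N + 2)) ≤ 1 / 2 := by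
        rw [← mul_div_assoc, div_le_div_iff₀ (by linarith) (by norm_num)]
        have : (k' : ℝ) * (k + 2) ≤ w * (w + w) := by
          gcongr
          linarith
        nlinarith
      linarith
    rw [heq, inv_pow] at hinv
    have h2 := hhalf.trans hinv
    rw [one_div] at h2
    exact (inv_le_inv₀ (by norm_num) (by positivity)).1 h2
  have hyk : ((1 + Γ) * δ) ^ k' ≤ 4 * w ^ 29 := by
    rw [mul_pow, hΓk]
    have : 0 ≤ 2 * w ^ 29 := by positivity
    nlinarith
  have hδy : δ ≤ (1 + Γ) * δ := by nlinarith
  have hNy : 2 * (N - m) ≤ (1 + Γ) * (N + 2) := by nlinarith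
  have hXy : 2 * ((N - m) / (N - k)) ≤ (1 + Γ) * δ := by
    rw [hδ, ← mul_div_assoc, ← mul_div_assoc]
    gcongr
  have hq : m / (N - m) ≤ δ := by
    rw [hδ, div_le_div_iff₀ hNm hNk]
    have h1 : m * (N - k) ≤ (N + 2) / 2 * (N - 2) := by
      apply mul_le_mul <;> linarith
    have h2 : (N + 2) / 2 * (N - 2) ≤ (N + 2) * (N - m) := by nlinarith
    linarith
  have hq0 : 0 ≤ m / (N - m) := by positivity
  refine ⟨(1 + Γ) * δ, hδ1.trans hδy, hyk, hN0, by linarith, ?_, ?_, ?_, hq0, ?_⟩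
  · refine le_trans ?_ hXy
    have : N - k ≤ N := by linarith
    gcongr
  · refine le_trans ?_ hδy
    rw [hδ, ← mul_div_assoc]
    gcongr
    linarith
  · exact (pow_le_pow_left₀ hq0 hq k').trans hδk
  · have : m / (N - k) * 2 = m / (N - m) * (2 * ((N - m) / (N - k))) := by
      field_simp
    rw [← mul_pow, this, mul_pow]
    gcongr
    exact (pow_le_pow_left₀ (by positivity) hXy k').trans hyk

/-- With these parameters, paths with a common root contribute a constant factor each, and paths
with different roots gain the factor `(m / (N - m)) ^ k'` if they never meet, and a power of `n` if
they do. -/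
theorem pairBound_estimates {n k' a l : ℕ} {w x y : ℝ} (hw : 5 ≤ w) (hn : (n : ℝ) = w ^ 100)
    (hk'w : (k' : ℝ) ≤ w) (haw : (a : ℝ) ≤ 2 * w ^ 5) (ha : 1 ≤ a) (hl : l + 1 ≤ k')
    (hlw : (1 / 2 : ℝ) ^ l ≤ 2 / w ^ 34) (hx0 : 0 ≤ x) (hx1 : x ≤ 1) (hxy : 2 * x ≤ y)
    (hy : 1 ≤ y) (hyk : y ^ k' ≤ 4 * w ^ 29) :
    (pairBound x n (aliveRev k' a l) k').1 ≤ 34 ∧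
    ∀ Q : ℝ, 0 ≤ Q → x ^ k' * 2 ^ k' ≤ Q * (4 * w ^ 29) →
      (pairBound x n (aliveRev k' a l) k').2 ≤ 8 * (Q + 1 / w ^ 59) := by
  have hw0 : 0 < w := by linarith
  have hkn : 2 * (k' : ℝ) / n ≤ 2 / w ^ 99 := by
    rw [hn, div_le_div_iff₀ (by positivity) (by positivity)]
    calc 2 * (k' : ℝ) * w ^ 99 ≤ 2 * w * w ^ 99 := by gcongr
      _ = _ := by ring
  have hT : y ^ k' * ((1 / 2) ^ l + 2 * k' / n) ≤ 16 / w ^ 5 := by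
    calc y ^ k' * ((1 / 2) ^ l + 2 * k' / n) ≤ 4 * w ^ 29 * (2 / w ^ 34 + 2 / w ^ 34) := by
          have h34 : 2 / w ^ 99 ≤ 2 / w ^ 34 := by
            gcongr
            · linarith
            · norm_num
          exact mul_le_mul hyk (add_le_add hlw (hkn.trans h34)) (by positivity) (by positivity)
      _ = _ := by
        field_simp
        ring
  obtain ⟨h1, h2⟩ := pairBound_top_le hx0 hx1 hxy hy ha hl (by
    calc (k' : ℝ) * (y ^ k' * ((1 / 2) ^ l + 2 * k' / n)) ≤ w * (16 / w ^ 5) := by gcongr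
      _ = 16 / w ^ 4 := by field_simp
      _ ≤ 1 := by
        rw [div_le_one (by positivity)]
        calc (16 : ℝ) ≤ 5 ^ 4 := by norm_num
          _ ≤ w ^ 4 := by gcongr)
  constructor
  · refine h1.trans ?_
    have : (a : ℝ) * (y ^ k' * ((1 / 2) ^ l + 2 * k' / n)) ≤ 2 * w ^ 5 * (16 / w ^ 5) := by gcongr
    have h3 : 2 * w ^ 5 * (16 / w ^ 5) = 32 := by
      field_simp
      norm_num
    linarith
  · intro Q hQ hxQ
    refine h2.trans ?_
    have h3 : (a : ℝ) * x ^ k' * 2 ^ (k' - l - 1) ≤ 8 * Q := by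
      have hpow : (2 : ℝ) ^ (k' - l - 1) = 2 ^ k' * (1 / 2) ^ l / 2 := by
        obtain ⟨t, rfl⟩ : ∃ t, k' = t + l + 1 := ⟨k' - l - 1, by omega⟩
        rw [show t + l + 1 - l - 1 = t by omega, pow_succ, pow_add, one_div, inv_pow]
        field_simp
      calc (a : ℝ) * x ^ k' * 2 ^ (k' - l - 1)
          = a * (x ^ k' * 2 ^ k') * (1 / 2) ^ l / 2 := by rw [hpow]; ring
        _ ≤ 2 * w ^ 5 * (Q * (4 * w ^ 29)) * (2 / w ^ 34) / 2 := by gcongr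
        _ = 8 * Q := by
          field_simp
          ring
    have h4 : (a : ℝ) * y ^ k' * (2 * k' / n) ≤ 8 * (1 / w ^ 59) := by
      calc (a : ℝ) * y ^ k' * (2 * k' / n) ≤ 2 * w ^ 5 * (4 * w ^ 29) * (2 / w ^ 99) := by gcongr
        _ = 16 / w ^ 65 := by
          field_simp
          ring
        _ ≤ 8 * (1 / w ^ 59) := by
          rw [← mul_div_assoc, div_le_div_iff₀ (by positivity) (by positivity)]
          have : (2 : ℝ) ≤ w ^ 6 := by
            calc (2 : ℝ) ≤ 5 ^ 6 := by norm_num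
              _ ≤ w ^ 6 := by gcongr
          calc 16 * w ^ 59 = 8 * 1 * (2 * w ^ 59) := by ring
            _ ≤ 8 * 1 * (w ^ 6 * w ^ 59) := by gcongr
            _ = _ := by ring
    linarith

/-- Passing from the natural exponent `D` to the real exponent `e` costs at most `3 ^ t`, even if
the base exceeds `1`. -/
theorem pow_le_rpow_mul {b e : ℝ} {D t : ℕ} (hb : 0 < b) (hb3 : b ≤ 3) (he : 0 ≤ e) (heD : e ≤ D)
    (hDt : D ≤ t) : b ^ D ≤ b ^ e * 3 ^ t := by
  have h1 : b ^ D = b ^ e * b ^ ((D : ℝ) - e) := by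
    rw [← Real.rpow_add hb, add_sub_cancel, Real.rpow_natCast]
  rw [h1]
  gcongr
  calc b ^ ((D : ℝ) - e) ≤ 3 ^ ((D : ℝ) - e) :=
        Real.rpow_le_rpow hb.le hb3 (by linarith)
    _ ≤ 3 ^ (t : ℝ) := by
        apply Real.rpow_le_rpow_of_exponent_le (by norm_num)
        have : (D : ℝ) ≤ t := by exact_mod_cast hDt
        linarith
    _ = 3 ^ t := Real.rpow_natCast 3 t

theorem card_rootOf_eq_le {n r' : ℕ} (v v' : Fin (2 * r') → Fin n) :
    (Finset.univ.filter fun h : Half r' => rootOf v h = rootOf v' h).card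
      ≤ (Finset.univ.filter fun i => v i = v' i).card := by
  refine Finset.card_le_card_of_injOn
    (fun h => ⟨2 * h.1 + if h.2 = true then 1 else 0, by split_ifs <;> omega⟩)
    (fun h hh => ?_) ?_
  · have hroot := (Finset.mem_filter.1 hh).2
    refine Finset.mem_filter.2 ⟨Finset.mem_univ _, ?_⟩
    obtain ⟨i, b⟩ := h
    cases b <;> simpa [rootOf] using hroot
  · rintro ⟨i, b⟩ _ ⟨i', b'⟩ _ h
    simp only [Fin.mk.injEq] at h
    cases b <;> cases b' <;> simp at h ⊢ <;> omega

end Numerics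

end IMMSkew

open IMMSkew in
theorem mainTheorem3 :
    ∃ C : ℕ, ∀ (F : Type*) [Field F] (n r' k' d k a l N m L₂ : ℕ) (τ ν r Γ : ℝ),
      -- the parameters; `a` and `l` are the roundings of `n ^ η` and `ε' log n`
      τ = 0.08 → ν = 0.631 → r = 2 * τ * r' →
      1 ≤ r' →
      d = (2 * k' + 3) * r' → (d : ℝ) ≤ (n : ℝ) ^ (0.01 : ℝ) →
      k = 2 * k' * r' →
      0.340 * Real.logb 2 n + 1 ≤ k' →
      |(a : ℝ) - (n : ℝ) ^ (0.05 : ℝ)| < 1 →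
      |(l : ℝ) - 0.340 * Real.logb 2 n| < 1 →
      N = 2 * r' * n * (a + 2 * (k' - l - 1) + l) →
      L₂ = (a * 2 ^ (k' - l - 1)) ^ (2 * r') →
      0 ≤ Γ → (1 + Γ) ^ k' = 2 * (n : ℝ) ^ (0.29 : ℝ) →
      |(m : ℝ) - N / 2 * (1 - Γ)| < 1 →
      ∀ (mo : MonomialOrder (ZVar n r' k')) (S : Set (Fin (2 * r') → Fin n)),
        (∀ v ∈ S, ∀ v' ∈ S, v ≠ v' →
          (((Finset.univ.filter fun i => v i = v' i).card : ℕ) : ℝ) ≤ r) →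
        -- the cardinalities named `N` and `L₂`, and the identity for `T₁`
        (∀ V ∈ restrictions n r' k' a l, (aliveVars V).card = N ∧
          ∀ α ∈ yMonomial k' '' S,
            (monoSet (restrictedIMM F V) α).card = L₂ ∧
            T1 (aliveVars V) m (restrictedIMM F V) α = L₂ * (N - k).choose m) ∧
        -- the bounds for `T₂(α)` and `T₃(α, α)` in expectation
        (∀ α ∈ yMonomial k' '' S,
          (Finset.expect (restrictions n r' k' a l) fun V =>
              (T2 (aliveVars V) m (restrictedIMM F V) α : ℝ))
            ≤ L₂ * (N - k).choose m * 2 ^ (C * r') ∧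
          (Finset.expect (restrictions n r' k' a l) fun V =>
              (T3 mo (aliveVars V) m (restrictedIMM F V) α α : ℝ))
            ≤ L₂ * (N - k).choose m * 2 ^ (C * r')) ∧
        -- the bound for `T₃(α, α')`, `α ≠ α'`, in expectation
        (∀ α ∈ yMonomial k' '' S, ∀ α' ∈ yMonomial k' '' S, α ≠ α' →
          (Finset.expect (restrictions n r' k' a l) fun V =>
              (T3 mo (aliveVars V) m (restrictedIMM F V) α α' : ℝ))
            ≤ L₂ * (N - k).choose m * 2 ^ (C * r') *
              (((m : ℝ) / ((N : ℝ) - m)) ^ k' + 1 / (n : ℝ) ^ ((1 - τ) * ν))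
                ^ (2 * (r' : ℝ) - r)) := by
  -- `2 ^ 14` exceeds `(34 * 3) ^ 2`: every half-block contributes at most `34 * 3`
  refine ⟨14, ?_⟩
  intro F _ n r' k' d k a l N m L₂ τ ν r Γ hτ hν hr hr' hd hdn hk hk' ha hl hN hL hΓ hΓk hm mo S hS
  obtain ⟨w, hw, hnw, hdw, haw, ha1, hk1, hlk, hlw, h29, h59⟩ :=
    exists_scale hr' hd hdn hk' ha hl
  have hw0 : 0 < w := by linarith
  have hnpos : 0 < n := by
    have : (0 : ℝ) < n := by
      rw [hnw]
      positivity
    exact_mod_cast this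
  have hkd : k ≤ d := by
    rw [hk, hd]
    exact Nat.mul_le_mul_right _ (by omega)
  have hk'd : k' ≤ d := by
    rw [hd]
    exact (by omega : k' ≤ 2 * k' + 3).trans (Nat.le_mul_of_pos_right _ hr')
  have hk'w : (k' : ℝ) ≤ w := le_trans (by exact_mod_cast hk'd) hdw
  have hk2 : 2 ≤ k := by
    rw [hk]
    exact (by omega : 2 ≤ 2 * k').trans (Nat.le_mul_of_pos_right _ hr')
  have hNw : w ^ 100 ≤ (N : ℝ) := by
    rw [← hnw, hN]
    have : n * 1 ≤ n * ((2 * r') * (a + 2 * (k' - l - 1) + l)) :=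
      Nat.mul_le_mul_left _ (Nat.mul_pos (by omega) (by omega))
    have h2 : n ≤ 2 * r' * n * (a + 2 * (k' - l - 1) + l) := by
      calc n = n * 1 := by ring
        _ ≤ _ := this
        _ = _ := by ring
    exact_mod_cast h2
  rw [h29] at hΓk
  obtain ⟨y, hy1, hyk, hN0, hmk, hxS, hxA, hQ2, hq0, hQ⟩ := ratio_bounds (k := (k : ℝ)) hw hNw
    (by exact_mod_cast hk2) (le_trans (by exact_mod_cast hkd) hdw) hk'w m.cast_nonneg hΓ hΓk hm
  have hmkN : m + k ≤ N := by exact_mod_cast hmk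
  have hN0' : 0 < N := by exact_mod_cast hN0
  have hmN : (m : ℝ) ≤ N := by exact_mod_cast (by omega : m ≤ N)
  have hNkpos : (0 : ℝ) < (N : ℝ) - k := by
    have : k < N := by
      have : (k : ℝ) < N := by
        have h1 : (k : ℝ) ≤ w := le_trans (by exact_mod_cast hkd) hdw
        have h2 : w ^ 1 < w ^ 100 := pow_lt_pow_right₀ (by linarith) (by norm_num)
        linarith [pow_one w]
      exact_mod_cast this
    exact sub_pos.2 (by exact_mod_cast this)
  have hV : ∀ V ∈ restrictions n r' k' a l, (aliveVars V).card = N := fun V hV => by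
    rw [card_aliveVars (mem_restrictions.1 hV), sum_numAlive hlk, hN]
  have hpaths : ∀ V ∈ restrictions n r' k' a l, ∀ ρ, (multiPaths V ρ).card = L₂ := fun V hV ρ => by
    rw [card_multiPaths (mem_restrictions.1 hV), prod_numAlive hlk, hL]
  have hLcast : ((∏ j, numAlive k' a l j : ℕ) : ℝ) ^ (2 * r') = L₂ := by
    rw [prod_numAlive hlk, hL]
    push_cast
    ring
  set D : ℝ := (((N - k).choose m : ℕ) : ℝ) with hD
  have hD0 : 0 ≤ D := Nat.cast_nonneg _
  set xS : ℝ := ((N : ℝ) - m) / N with hxSdef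
  set xA : ℝ := (m : ℝ) / ((N : ℝ) - k) with hxAdef
  have hxS0 : 0 ≤ xS := div_nonneg (by linarith) hN0.le
  have hxS1 : xS ≤ 1 := by
    rw [hxSdef, div_le_one hN0]
    linarith [m.cast_nonneg (α := ℝ)]
  have hxA0 : 0 ≤ xA := div_nonneg m.cast_nonneg hNkpos.le
  have hxA1 : xA ≤ 1 := by
    rw [hxAdef, div_le_one hNkpos]
    linarith
  obtain ⟨hαS, -⟩ := pairBound_estimates hw hnw hk'w haw ha1 hlk hlw hxS0 hxS1 hxS hy1 hyk
  obtain ⟨hαA, hβA⟩ := pairBound_estimates hw hnw hk'w haw ha1 hlk hlw hxA0 hxA1 hxA hy1 hyk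
  specialize hβA _ (pow_nonneg hq0 k') hQ
  have hG := one_le_aliveRev (k' := k') (l := l) ha1
  have hE2 := fun v => expect_T2_le F hnpos ha1 v (m := m) hk (by omega) hN0' hV
  have hE3 := fun v v' => expect_T3_le F hnpos ha1 mo v v' hk hmkN hV
  simp only [hLcast, ← hD, ← hxSdef, ← hxAdef] at hE2 hE3
  have hconst : ∀ A : ℝ, 0 ≤ A → A ≤ 34 → ∏ _h : Half r', A ≤ 2 ^ (14 * r') := by
    intro A hA0 hA
    rw [Finset.prod_const, Finset.card_univ, Fintype.card_prod, Fintype.card_fin,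
      Fintype.card_bool, mul_comm r' 2, pow_mul, pow_mul]
    gcongr
    calc A ^ 2 ≤ 34 ^ 2 := by gcongr
      _ ≤ 2 ^ 14 := by norm_num
  refine ⟨fun V hVr => ⟨hV V hVr, ?_⟩, ?_, ?_⟩
  · rintro _ ⟨v, _, rfl⟩
    rw [card_monoSet F hnpos, T1_restrictedIMM F hnpos, hpaths V hVr, hV V hVr, hk]
    exact ⟨rfl, rfl⟩
  · rintro _ ⟨v, _, rfl⟩
    constructor
    · refine (hE2 v).trans ?_
      rw [mul_left_comm, mul_assoc]
      gcongr
      exact hconst _ (pairBound_nonneg hxS0 n hG k').1 hαS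
    · refine (hE3 v v).trans ?_
      simp only [if_true]
      rw [mul_left_comm, mul_assoc]
      gcongr
      exact hconst _ (pairBound_nonneg hxA0 n hG k').1 hαA
  · rintro _ ⟨v, hvS, rfl⟩ _ ⟨v', hvS', rfl⟩ hne
    have hagree := hS v hvS v' hvS' fun h => hne (by rw [h])
    have hpowpos : (0 : ℝ) < (n : ℝ) ^ ((1 - τ) * ν) :=
      Real.rpow_pos_of_pos (by exact_mod_cast hnpos) _
    have hn59 : 1 / w ^ 59 ≤ 1 / (n : ℝ) ^ ((1 - τ) * ν) := by
      apply one_div_le_one_div_of_le hpowpos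
      rw [hτ, hν]
      exact h59
    have hn1 : 1 / (n : ℝ) ^ ((1 - τ) * ν) ≤ 1 := by
      rw [div_le_one hpowpos]
      apply Real.one_le_rpow (by exact_mod_cast hnpos)
      rw [hτ, hν]
      norm_num
    set b : ℝ := ((m : ℝ) / ((N : ℝ) - m)) ^ k' + 1 / (n : ℝ) ^ ((1 - τ) * ν) with hb
    have hb0 : 0 < b := add_pos_of_nonneg_of_pos (pow_nonneg hq0 _) (one_div_pos.2 hpowpos)
    have hb3 : b ≤ 3 := by linarith
    have hβb : (pairBound xA n (aliveRev k' a l) k').2 ≤ 34 * b := by linarith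
    obtain ⟨hα0, hβ0⟩ := pairBound_nonneg hxA0 n hG k'
    set E : ℕ := (Finset.univ.filter fun h : Half r' => ¬ rootOf v h = rootOf v' h).card with hE
    have hcardH : (Finset.univ : Finset (Half r')).card = 2 * r' := by
      simp [mul_comm]
    have hsplit : (Finset.univ.filter fun h : Half r' => rootOf v h = rootOf v' h).card + E
        = 2 * r' := by
      rw [hE, Finset.card_filter_add_card_filter_not, hcardH]
    have hrE : 2 * (r' : ℝ) - r ≤ E := by
      have h1 : ((Finset.univ.filter fun h : Half r' => rootOf v h = rootOf v' h).card : ℝ) ≤ r :=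
        le_trans (by exact_mod_cast card_rootOf_eq_le v v') hagree
      have h2 : ((Finset.univ.filter fun h : Half r' => rootOf v h = rootOf v' h).card : ℝ) + E
        = 2 * r' := by exact_mod_cast hsplit
      linarith
    have hr0 : 0 ≤ 2 * (r' : ℝ) - r := by
      rw [hr, hτ]
      linarith [r'.cast_nonneg (α := ℝ)]
    refine (hE3 v v').trans ?_
    rw [mul_left_comm, mul_assoc, mul_assoc]
    gcongr
    calc (∏ h, if rootOf v h = rootOf v' h then (pairBound xA n (aliveRev k' a l) k').1
          else (pairBound xA n (aliveRev k' a l) k').2)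
        ≤ ∏ h : Half r', 34 * if rootOf v h = rootOf v' h then 1 else b := by
          refine Finset.prod_le_prod (fun h _ => by split_ifs <;> assumption) fun h _ => ?_
          split_ifs <;> linarith
      _ = 34 ^ (2 * r') * b ^ E := by
          rw [Finset.prod_mul_distrib, Finset.prod_const, hcardH, Finset.prod_ite,
            Finset.prod_const_one, one_mul, Finset.prod_const]
      _ ≤ 34 ^ (2 * r') * (b ^ (2 * (r' : ℝ) - r) * 3 ^ (2 * r')) := by
          gcongr
          exact pow_le_rpow_mul hb0 hb3 hr0 hrE (by omega)
      _ = (34 ^ 2 * 3 ^ 2) ^ r' * b ^ (2 * (r' : ℝ) - r) := by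
          rw [mul_pow, ← pow_mul, ← pow_mul]
          ring
      _ ≤ 2 ^ (14 * r') * b ^ (2 * (r' : ℝ) - r) := by
          rw [pow_mul 2 14]
          gcongr
          norm_num
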